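/- An *ordered continuum* is a nondegenerate compact connected space $\Lambda$ whose topology is the order topology of a linear order on it. It is *order-homogeneous* if $\Lambda$ is homeomorphic to $[x,y]$ for all $x<y$ in $\Lambda$. For $n\ge 1$ let $\Sigma^{(n)}$ be the quotient space of $\{0,\dots,n-1\}\times\Lambda$ ($n$ copies of $\Lambda$) in which, for each $i$, the last point of the $i$th copy is identified with the first point of the copy with index $i+1 \bmod n$, and let $\phi^m_n:\Sigma^{(mn)}\to\Sigma^{(n)}$ be the map that sends the point $x$ of the $i$th copy to the point $x$ of the copy with index $i \bmod n$. For a sequence $\vec p=\langle p_1,p_2,\dots\rangle$ of integers $\ge 2$ put $k(1)=1$, $k(n)=p_1p_2\cdots p_{n-1}$ for $n>1$, and $$S(\Lambda,\vec p)=\varprojlim\{\phi^{p_n}_{k(n)},\Sigma^{(k(n))},n\in\mathbb N\}.$$ A *continuum* is a nonempty compact connected Hausdorff space. A space is *homogeneous* if for any two points $x,y$ some homeomorphism of the space onto itself sends $x$ to $y$. A continuum is *indecomposable* if it is not the union of two proper subcontinua, and *circle-like* if every open cover has a finite open refinement $\{U_1,\dots,U_t\}$, $t\ge 3$, that covers the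 space and is a circular chain: $U_i\cap U_j\ne\emptyset$ if and only if $i-j\equiv -1$, $0$ or $1 \pmod t$. (a) There is a nonmetrizable order-homogeneous ordered continuum. (b) If $\Lambda$ is any nonmetrizable order-homogeneous ordered continuum, then for every sequence $\vec p$ of integers $\ge 2$ the space $S(\Lambda,\vec p)$ is a nonmetrizable homogeneous indecomposable circle-like continuum. In particular, there is an ordered continuum $\Lambda$ such that, for every such $\vec p$, $S(\Lambda,\vec p)$ is a nonmetrizable homogeneous indecomposable circle-like continuum. -/

import Mathlib

universe u

namespace LongSolenoid

/-- An ordered continuum: a nondegenerate compact connected space whose topology is the order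
topology of a linear order. -/
structure IsOrderedContinuum (L : Type u) [LinearOrder L] [TopologicalSpace L] : Prop where
  orderTopology : OrderTopology L
  compactSpace : CompactSpace L
  connectedSpace : ConnectedSpace L
  nontrivial : Nontrivial L

/-- `L` is order-homogeneous: it is homeomorphic to `[x, y]` whenever `x < y`. -/
def IsOrderHomogeneous (L : Type u) [LinearOrder L] [TopologicalSpace L] : Prop :=
  ∀ x y : L, x < y → Nonempty (L ≃ₜ Set.Icc x y)

/-- The identification of the right endpoint of the `i`th of `n` copies of `L` with the left
endpoint of the next copy, cyclically; for `n = 1` the two endpoints of `L` are identified. -/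
inductive Glue (L : Type u) [LinearOrder L] [BoundedOrder L] (n : ℕ) :
    Fin n × L → Fin n × L → Prop
  | mk (i j : Fin n) (h : (j : ℕ) = ((i : ℕ) + 1) % n) : Glue L n (i, ⊤) (j, ⊥)

/-- The circle made of `n` copies of `L` laid end to end, with the quotient topology. (`Quot`
divides by the equivalence relation that `Glue` generates.) -/
abbrev Circ (L : Type u) [LinearOrder L] [BoundedOrder L] (n : ℕ) : Type u :=
  Quot (Glue L n)

/-- The `m`-fold covering map from the circle of `m * n` copies to the circle of `n` copies; it
sends the point `x` of the `i`th copy to the point `x` of the copy with number `i` mod `n`. -/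
def bond (L : Type u) [LinearOrder L] [BoundedOrder L] (m n : ℕ) :
    Circ L (m * n) → Circ L n :=
  Quot.map (fun q : Fin (m * n) × L => (q.1.modNat, q.2)) (by
    rintro _ _ ⟨i, j, h⟩
    refine Glue.mk _ _ ?_
    simp only [Fin.modNat, h, Nat.mod_mul_left_mod, Nat.mod_add_mod])

/-- The number of copies in the factor spaces: `1, p 0, p 0 * p 1, …`. -/
def copies (p : ℕ → ℕ) : ℕ → ℕ
  | 0 => 1
  | n + 1 => p n * copies p n

/-- The inverse limit of the circles `Circ L (copies p n)` along the covering maps, as a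
subspace of the product. -/
abbrev Solenoid (L : Type u) [LinearOrder L] [BoundedOrder L] [TopologicalSpace L]
    (p : ℕ → ℕ) : Type u :=
  {s : (n : ℕ) → Circ L (copies p n) // ∀ n, bond L (p n) (copies p n) (s (n + 1)) = s n}

/-- A continuum: a nonempty compact connected Hausdorff space. -/
structure IsContinuum (X : Type u) [TopologicalSpace X] : Prop where
  compactSpace : CompactSpace X
  connectedSpace : ConnectedSpace X
  t2Space : T2Space X

/-- Any point can be moved to any other point by an autohomeomorphism. -/
def IsHomogeneous (X : Type u) [TopologicalSpace X] : Prop :=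
  ∀ x y : X, ∃ h : X ≃ₜ X, h x = y

/-- `X` is not the union of two proper subcontinua. -/
def IsIndecomposable (X : Type u) [TopologicalSpace X] : Prop :=
  ¬ ∃ C D : Set X, (IsCompact C ∧ IsConnected C ∧ C ≠ Set.univ) ∧
    (IsCompact D ∧ IsConnected D ∧ D ≠ Set.univ) ∧ C ∪ D = Set.univ

/-- Two links of the family intersect exactly when their indices differ by at most one
modulo `t`. -/
def IsCircularChain {X : Type u} {t : ℕ} (U : Fin t → Set X) : Prop :=
  ∀ i j : Fin t, (U i ∩ U j).Nonempty ↔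
    ((i : ℕ) ≡ j [MOD t] ∨ (i : ℕ) + 1 ≡ j [MOD t] ∨ (i : ℕ) ≡ j + 1 [MOD t])

/-- Every open cover has a finite open refinement that covers `X` and forms a circular chain. -/
def IsCircleLike (X : Type u) [TopologicalSpace X] : Prop :=
  ∀ 𝒰 : Set (Set X), (∀ V ∈ 𝒰, IsOpen V) → ⋃₀ 𝒰 = Set.univ →
    ∃ t : ℕ, 3 ≤ t ∧ ∃ U : Fin t → Set X, (∀ i, IsOpen (U i)) ∧ (⋃ i, U i) = Set.univ ∧
      (∀ i, ∃ V ∈ 𝒰, U i ⊆ V) ∧ IsCircularChain U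

end LongSolenoid

open LongSolenoid

/-!
Existence. The set of sequences in `[0, 1]` with the lexicographic order (`LexCube`) is complete and
densely ordered, hence an ordered continuum, and it is not separable. The open initial segment
`{z | z < x}` is the sum, over those `n` with `x n > 0`, of the sets of all `z` that first differ
from `x` at `n`, and each of these is isomorphic to `[0, 1) × LexCube`. Countably many copies of
`[0, 1)` in a row again make up one `[0, 1)`, so all proper open initial segments are isomorphic to
`[0, 1) × LexCube` (`LexCube.image_code`). Order-homogeneity follows by reflection.

Homogeneity. A homeomorphism of an order-homogeneous `L` onto one of its intervals may reverse the
order, but increasing ones always exist (`exists_increasingParam`): if `L` is not anti-isomorphic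
to itself, then two adjacent intervals cannot be of opposite kinds, as exchanging them would reverse
their union. For `⊥ < t < ⊤` there is thus an increasing homeomorphism `[⊥, t] → [t, ⊤]`; it and its
inverse, used alternately, form a homeomorphism of every circle of copies of `L`, a square root of
the rotation by one copy, which moves the first point of a copy to the point `t` of that copy
(`exists_halfRotation`). These maps commute with the covering maps, and so move any point of the
inverse limit into the fibre over the vertex of the first circle. On that fibre the compatible
systems of rotations are transitive (`exists_homeo_of_apply_zero_eq`).

The other properties. `L` embeds in the inverse limit, as some circle has at least two copies of
`L`; so the limit is not metrizable. If a subcontinuum misses the base point, then at some level it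
misses the fibre over the vertex of the level before, so it lies in one of the arcs into which this
fibre cuts the circle; a closed set that contains the rest contains another arc, and that forces it
to be everything (`eq_univ_of_union_eq_univ`). Finally, an open cover is refined at some level, and
a fine subdivision of `L` maps the circle of that level onto a metric circle so that preimages of
short arcs are small; chains of arcs of the metric circle pull back (`isCircleLike_circ`).
-/

namespace LongSolenoid

/-! ### A nonmetrizable order-homogeneous ordered continuum -/

/-- The set of sequences in `[0, 1]`, ordered lexicographically. -/
abbrev LexCube : Type := Lex (ℕ → Set.Icc (0 : ℝ) 1)

namespace LexCube

instance : @DenselyOrdered LexCube Preorder.toLT :=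
  inferInstanceAs (@DenselyOrdered (Lex (ℕ → Set.Icc (0 : ℝ) 1)) Pi.instLTLexForall)

theorem lt_iff {x y : LexCube} : x < y ↔ ∃ i, (∀ j < i, x j = y j) ∧ x i < y i := Iff.rfl

/-- The first coordinate at which two sequences differ. -/
noncomputable def split (x z : LexCube) : ℕ := PiNat.firstDiff (E := fun _ => Set.Icc (0 : ℝ) 1) z x

theorem apply_eq_of_lt_split {x z : LexCube} {j : ℕ} (h : j < split x z) : z j = x j :=
  PiNat.apply_eq_of_lt_firstDiff h

theorem split_eq {x z : LexCube} {n : ℕ} (h : ∀ j < n, z j = x j) (hn : z n ≠ x n) :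
    split x z = n := by
  have hne : (z : ℕ → Set.Icc (0 : ℝ) 1) ≠ x := fun e => hn (congrFun e n)
  refine le_antisymm ?_ ?_
  · by_contra hlt
    exact hn (apply_eq_of_lt_split (not_le.1 hlt))
  · by_contra hlt
    exact PiNat.apply_firstDiff_ne hne (h _ (not_le.1 hlt))

theorem apply_split_lt {x z : LexCube} (h : z < x) : z (split x z) < x (split x z) := by
  obtain ⟨n, h1, h2⟩ := lt_iff.1 h
  rw [split_eq h1 h2.ne]
  exact h2

/-- The partial sums of `∑ x i / 2 ^ i`. -/
noncomputable def partialSum (x : LexCube) (n : ℕ) : ℝ :=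
  ∑ i ∈ Finset.range n, (x i : ℝ) / 2 ^ i

/-- The sum of the series `∑ x i / 2 ^ i`. -/
noncomputable def total (x : LexCube) : ℝ := ∑' i, (x i : ℝ) / 2 ^ i

theorem summable (x : LexCube) : Summable fun i => (x i : ℝ) / 2 ^ i := by
  refine Summable.of_nonneg_of_le (fun i => ?_) (fun i => ?_)
    (summable_geometric_of_lt_one (r := 1 / 2) (by norm_num) (by norm_num))
  · exact div_nonneg (x i).2.1 (by positivity)
  · rw [one_div, inv_pow, div_eq_mul_inv]
    exact mul_le_of_le_one_left (by positivity) (x i).2.2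

theorem partialSum_succ (x : LexCube) (n : ℕ) :
    partialSum x (n + 1) = partialSum x n + (x n : ℝ) / 2 ^ n := Finset.sum_range_succ _ _

theorem partialSum_mono (x : LexCube) : Monotone (partialSum x) :=
  monotone_nat_of_le_succ fun n => by
    rw [partialSum_succ]
    linarith [div_nonneg (x n).2.1 (by positivity : (0 : ℝ) ≤ 2 ^ n)]

theorem partialSum_nonneg (x : LexCube) (n : ℕ) : 0 ≤ partialSum x n := by
  simpa [partialSum] using partialSum_mono x (Nat.zero_le n)

theorem tendsto_partialSum (x : LexCube) :
    Filter.Tendsto (partialSum x) Filter.atTop (nhds (total x)) :=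
  (summable x).hasSum.tendsto_sum_nat

theorem partialSum_le_total (x : LexCube) (n : ℕ) : partialSum x n ≤ total x :=
  (partialSum_mono x).ge_of_tendsto (tendsto_partialSum x) n

theorem total_pos {x : LexCube} (hx : ⊥ < x) : 0 < total x := by
  obtain ⟨n, -, h⟩ := lt_iff.1 hx
  have h0 : (0 : ℝ) < x n := h
  refine lt_of_lt_of_le ?_ (partialSum_le_total x (n + 1))
  rw [partialSum_succ]
  have := partialSum_nonneg x n
  positivity

/-- For `z < x`, a lexicographic code of `z` whose range, `[0, 1) × LexCube`, does not depend on
`x`: if `n` is the first coordinate where `z` and `x` differ, then the real number places the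
interval of all such `z` behind those of smaller `n`, and the tail of `z` after `n` is kept. -/
noncomputable def code (x z : LexCube) : Lex (ℝ × LexCube) :=
  toLex ((partialSum x (split x z) + (z (split x z) : ℝ) / 2 ^ split x z) / total x,
    toLex fun k => z (split x z + 1 + k))

theorem code_lt_code {x z w : LexCube} (hx : ⊥ < x) (hzw : z < w) (hw : w < x) :
    code x z < code x w := by
  have hz := hzw.trans hw
  have ht := total_pos hx
  have hzn := apply_split_lt hz
  have hwn := apply_split_lt hw
  rw [code, code, Prod.Lex.toLex_lt_toLex]
  obtain ⟨m, hm, hm'⟩ := lt_iff.1 hzw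
  rcases lt_trichotomy (split x z) (split x w) with h | h | h
  · left
    simp only
    rw [div_lt_div_iff_of_pos_right ht]
    calc partialSum x (split x z) + (z (split x z) : ℝ) / 2 ^ split x z
        < partialSum x (split x z + 1) := by
          rw [partialSum_succ]; gcongr
      _ ≤ partialSum x (split x w) := partialSum_mono x h
      _ ≤ _ := by
          have := div_nonneg (w (split x w)).2.1 (by positivity : (0 : ℝ) ≤ 2 ^ split x w)
          linarith
  · rw [← h]
    have hnm : split x z ≤ m := by
      by_contra hlt
      have h1 : z m = x m := apply_eq_of_lt_split (not_le.1 hlt)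
      have h2 : w m = x m := apply_eq_of_lt_split (h ▸ not_le.1 hlt)
      exact (h1.trans h2.symm).not_lt hm'
    rcases hnm.eq_or_lt with e | hlt
    · left
      simp only
      rw [div_lt_div_iff_of_pos_right ht]
      gcongr
      rw [e]; exact hm'
    · right
      refine ⟨by simp only [hm _ hlt], lt_iff.2 ⟨m - (split x z + 1), fun j hj => ?_, ?_⟩⟩
      · exact hm _ (by omega)
      · have e : split x z + 1 + (m - (split x z + 1)) = m := by omega
        change z (split x z + 1 + (m - (split x z + 1))) < w (split x z + 1 + (m - (split x z + 1)))
        rw [e]; exact hm'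
  · refine absurd (lt_iff.2 ⟨split x w, fun j hj => ?_, ?_⟩) hzw.not_gt
    · exact (apply_eq_of_lt_split hj).trans (apply_eq_of_lt_split (hj.trans h)).symm
    · exact hwn.trans_eq (apply_eq_of_lt_split h).symm

theorem image_code {x : LexCube} (hx : ⊥ < x) :
    code x '' Set.Iio x = {p | 0 ≤ (ofLex p).1 ∧ (ofLex p).1 < 1} := by
  have ht := total_pos hx
  ext p
  constructor
  · rintro ⟨z, hz, rfl⟩
    have hzn := apply_split_lt hz
    constructor
    · have := partialSum_nonneg x (split x z)
      have := (z (split x z)).2.1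
      simp only [code, ofLex_toLex]
      positivity
    · simp only [code, ofLex_toLex]
      rw [div_lt_one ht]
      refine lt_of_lt_of_le ?_ (partialSum_le_total x (split x z + 1))
      rw [partialSum_succ]; gcongr
  · rintro ⟨h0, h1⟩
    obtain ⟨⟨s, w⟩, rfl⟩ := toLex.surjective p
    simp only [ofLex_toLex] at h0 h1
    -- `s` falls into the `n`th interval, where `n + 1` is the first index whose partial sum exceeds
    -- `s * total x`
    have hex : ∃ n, s * total x < partialSum x n :=
      ((tendsto_partialSum x).eventually_const_lt (by nlinarith)).exists
    classical
    obtain ⟨n, hn⟩ : ∃ n, Nat.find hex = n + 1 := by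
      refine Nat.exists_eq_succ_of_ne_zero fun h => ?_
      have := Nat.find_spec hex
      rw [h, partialSum, Finset.range_zero, Finset.sum_empty] at this
      nlinarith
    have hlt : s * total x < partialSum x (n + 1) := hn ▸ Nat.find_spec hex
    have hle : partialSum x n ≤ s * total x := not_lt.1 (Nat.find_min hex (by omega))
    rw [partialSum_succ] at hlt
    have h2 : (0 : ℝ) < 2 ^ n := by positivity
    have hv : (s * total x - partialSum x n) * 2 ^ n < x n := by
      rw [← lt_div_iff₀ h2]; linarith
    have hv0 : 0 ≤ (s * total x - partialSum x n) * 2 ^ n :=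
      mul_nonneg (by linarith) h2.le
    let v : Set.Icc (0 : ℝ) 1 := ⟨(s * total x - partialSum x n) * 2 ^ n, hv0, hv.le.trans (x n).2.2⟩
    let z : LexCube := toLex fun i => if i < n then x i else if i = n then v else w (i - (n + 1))
    have z1 : ∀ j < n, z j = x j := fun j hj => by simp [z, hj]
    have z2 : z n = v := by simp [z]
    have z3 : z n < x n := by rw [z2]; exact hv
    refine ⟨z, lt_iff.2 ⟨n, z1, z3⟩, ?_⟩
    rw [code, split_eq z1 z3.ne, z2]
    congr 2
    · simp only [v]
      field_simp
      ring
    · refine funext fun k => ?_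
      have e1 : ¬ n + 1 + k < n := by omega
      have e2 : ¬ n + 1 + k = n := by omega
      have e3 : n + 1 + k - (n + 1) = k := by omega
      simp only [z, Pi.toLex_apply, e1, e2, e3, if_false]

/-- All proper open initial segments of `LexCube` are isomorphic. -/
noncomputable def iioIso {x y : LexCube} (hx : ⊥ < x) (hy : ⊥ < y) : Set.Iio x ≃o Set.Iio y :=
  ((StrictMonoOn.orderIso (code x) (Set.Iio x)
      fun _ _ _ hb h => code_lt_code hx h hb).trans
    (OrderIso.setCongr _ _ ((image_code hx).trans (image_code hy).symm))).trans
    (StrictMonoOn.orderIso (code y) (Set.Iio y)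
      fun _ _ _ hb h => code_lt_code hy h hb).symm

theorem exists_strictMono_range_eq_Iic {y : LexCube} (hy : ⊥ < y) :
    ∃ f : LexCube → LexCube, StrictMono f ∧ Set.range f = Set.Iic y := by
  classical
  have ht : (⊥ : LexCube) < ⊤ := hy.trans_le le_top
  let e := iioIso ht hy
  let f : LexCube → LexCube := fun z => if h : z < ⊤ then (e ⟨z, h⟩ : LexCube) else y
  have f1 : ∀ {z} (h : z < ⊤), f z = e ⟨z, h⟩ := fun h => dif_pos h
  have f2 : f ⊤ = y := dif_neg (lt_irrefl _)
  refine ⟨f, fun a b hab => ?_, ?_⟩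
  · have ha := hab.trans_le le_top
    rw [f1 ha]
    rcases (le_top : b ≤ ⊤).lt_or_eq with hb | rfl
    · rw [f1 hb]
      exact e.strictMono hab
    · rw [f2]
      exact (e ⟨a, ha⟩).2
  · ext w
    constructor
    · rintro ⟨z, rfl⟩
      rcases (le_top : z ≤ ⊤).lt_or_eq with hz | rfl
      · rw [f1 hz]; exact le_of_lt (Set.mem_Iio.1 (e ⟨z, hz⟩).2)
      · exact f2.le
    · intro hw
      rcases (show w ≤ y from hw).lt_or_eq with hw | rfl
      · refine ⟨e.symm ⟨w, hw⟩, ?_⟩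
        rw [f1 (e.symm ⟨w, hw⟩).2]
        simp
      · exact ⟨⊤, f2⟩

/-- The reflection `x ↦ 1 - x` in every coordinate. -/
def flip (x : LexCube) : LexCube :=
  toLex fun i => ⟨1 - x i, by linarith [(x i).2.2], by linarith [(x i).2.1]⟩

theorem flip_flip (x : LexCube) : flip (flip x) = x := by
  refine funext fun i => Subtype.ext ?_
  change 1 - (1 - (x i : ℝ)) = x i
  ring

theorem flip_strictAnti : StrictAnti flip := fun x y h => by
  obtain ⟨i, h1, h2⟩ := lt_iff.1 h
  refine lt_iff.2 ⟨i, fun j hj => Subtype.ext ?_, ?_⟩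
  · change 1 - (y j : ℝ) = 1 - x j
    rw [h1 j hj]
  · change 1 - (y i : ℝ) < 1 - x i
    have : (x i : ℝ) < y i := h2
    linarith

/-- `[x, y]` is a final segment of `[⊥, y]`, which is isomorphic to the whole of `LexCube`; and
final segments are reflected initial segments. -/
theorem exists_strictMono_range_eq_Icc {x y : LexCube} (hxy : x < y) :
    ∃ f : LexCube → LexCube, StrictMono f ∧ Set.range f = Set.Icc x y := by
  obtain ⟨f, hf, hfr⟩ := exists_strictMono_range_eq_Iic (bot_le.trans_lt hxy)
  obtain ⟨x', rfl⟩ : x ∈ Set.range f := hfr ▸ hxy.le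
  obtain ⟨g, hg, hgr⟩ := exists_strictMono_range_eq_Iic (y := flip x') (by
    refine lt_of_le_of_ne bot_le fun h => ?_
    have h' : ∀ w, w ≤ x' := fun w => by
      rw [← flip_strictAnti.le_iff_ge, ← h]; exact bot_le
    obtain ⟨y', rfl⟩ : y ∈ Set.range f := hfr ▸ le_refl y
    exact (hf.monotone (h' y')).not_gt hxy)
  refine ⟨fun z => f (flip (g (flip z))), fun a b h =>
    hf (flip_strictAnti (hg (flip_strictAnti h))), ?_⟩
  ext w
  constructor
  · rintro ⟨z, rfl⟩
    have h1 : g (flip z) ≤ flip x' := by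
      have : g (flip z) ∈ Set.Iic (flip x') := hgr ▸ Set.mem_range_self _
      exact this
    refine ⟨hf.monotone ?_, ?_⟩
    · rw [← flip_strictAnti.le_iff_ge, flip_flip]; exact h1
    · have : f (flip (g (flip z))) ∈ Set.Iic y := hfr ▸ Set.mem_range_self _
      exact this
  · rintro ⟨h1, h2⟩
    obtain ⟨w, rfl⟩ : w ∈ Set.range f := hfr ▸ h2
    have h3 : flip w ∈ Set.Iic (flip x') := flip_strictAnti.le_iff_ge.2 (hf.le_iff_le.1 h1)
    rw [← hgr] at h3
    obtain ⟨z, hz⟩ := h3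
    exact ⟨flip z, by simp only [flip_flip, hz]⟩

/-- There are uncountably many disjoint open intervals, one for each first coordinate. -/
theorem not_metrizableSpace [TopologicalSpace LexCube] [OrderTopology LexCube] :
    ¬ TopologicalSpace.MetrizableSpace LexCube := by
  intro h
  let := TopologicalSpace.metrizableSpaceMetric LexCube
  let lo : Set.Icc (0 : ℝ) 1 → LexCube := fun a => toLex fun i => if i = 0 then a else ⊥
  let hi : Set.Icc (0 : ℝ) 1 → LexCube := fun a => toLex fun i => if i = 0 then a else ⊤
  have hlt : ∀ a, lo a < hi a := fun a => lt_iff.2 ⟨1, fun j hj => by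
      obtain rfl : j = 0 := by omega
      rfl, by
      change (⊥ : Set.Icc (0 : ℝ) 1) < ⊤
      exact bot_lt_top⟩
  have hcount := Set.PairwiseDisjoint.countable_of_isOpen (s := fun a => Set.Ioo (lo a) (hi a))
    (a := Set.univ) (by
      have key : ∀ a b, a < b → hi a < lo b := fun a b hab => lt_iff.2 ⟨0, by simp, hab⟩
      intro a _ b _ hab
      refine Set.disjoint_left.2 fun w hw hw' => ?_
      rcases lt_or_gt_of_ne hab with h | h
      · exact lt_asymm (hw.2.trans (key a b h)) hw'.1
      · exact lt_asymm (hw'.2.trans (key b a h)) hw.1)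
    (fun a _ => isOpen_Ioo) (fun a _ => Set.nonempty_Ioo.2 (hlt a))
  have : (Set.Icc (0 : ℝ) 1).Countable := by
    rw [← Set.countable_coe_iff]
    exact Set.countable_univ_iff.1 hcount
  exact absurd this (by
    rw [← Cardinal.le_aleph0_iff_set_countable, Cardinal.mk_Icc_real zero_lt_one, not_le]
    exact Cardinal.aleph0_lt_continuum)

end LexCube

/-- The lexicographically ordered cube is the example; it is lifted to the given universe. -/
theorem exists_nonmetrizable :
    ∃ (L : Type u) (_ : LinearOrder L) (_ : BoundedOrder L) (_ : TopologicalSpace L),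
      IsOrderedContinuum L ∧ IsOrderHomogeneous L ∧ ¬ TopologicalSpace.MetrizableSpace L := by
  let τ : TopologicalSpace LexCube := Preorder.topology _
  have hτ : OrderTopology LexCube := ⟨rfl⟩
  let σ : TopologicalSpace (ULift.{u} LexCube) := Preorder.topology _
  have hσ : OrderTopology (ULift.{u} LexCube) := ⟨rfl⟩
  let e : ULift.{u} LexCube ≃o LexCube := ⟨Equiv.ulift, Iff.rfl⟩
  let h : ULift.{u} LexCube ≃ₜ LexCube := e.toHomeomorph
  refine ⟨ULift.{u} LexCube, inferInstance,
    { top := ⟨⊤⟩, bot := ⟨⊥⟩, le_top := fun x => (le_top : x.down ≤ ⊤),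
      bot_le := fun x => (bot_le : ⊥ ≤ x.down) }, σ, ⟨hσ, ?_, ?_, ?_⟩, ?_, ?_⟩
  · exact h.symm.compactSpace
  · have : ConnectedSpace LexCube :=
      { toPreconnectedSpace := inferInstance, toNonempty := ⟨⊥⟩ }
    exact h.symm.surjective.connectedSpace h.symm.continuous
  · exact e.toEquiv.nontrivial
  · intro x y hxy
    obtain ⟨f, hf, hfr⟩ := LexCube.exists_strictMono_range_eq_Icc (e.strictMono hxy)
    have hg : StrictMono fun z => e.symm (f (e z)) :=
      e.symm.strictMono.comp (hf.comp e.strictMono)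
    have hgr : Set.range (fun z => e.symm (f (e z))) = Set.Icc x y := by
      ext w
      have : e w ∈ Set.range f ↔ e w ∈ Set.Icc (e x) (e y) := by rw [hfr]
      simp only [Set.mem_Icc, OrderIso.le_iff_le] at this
      rw [Set.mem_Icc, ← this]
      constructor
      · rintro ⟨z, rfl⟩
        exact ⟨e z, by simp⟩
      · rintro ⟨z, hz⟩
        exact ⟨e.symm z, by simp [hz]⟩
    exact ⟨((StrictMono.orderIso _ hg).trans (OrderIso.setCongr _ _ hgr)).toHomeomorph⟩
  · intro hm
    exact LexCube.not_metrizableSpace h.symm.isEmbedding.metrizableSpace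

/-! ### Order-homogeneity by increasing homeomorphisms -/

section Order

variable {L : Type u} [LinearOrder L]

/-- A strictly decreasing map onto a closed interval carries closed intervals onto closed
intervals, exchanging the end points. -/
theorem range_comp_of_strictAnti {f g : L → L} {a b x y : L} (hf : StrictAnti f)
    (hfr : Set.range f = Set.Icc a b) (hgr : Set.range g = Set.Icc x y) :
    Set.range (f ∘ g) = Set.Icc (f y) (f x) := by
  rw [Set.range_comp, hgr]
  ext w
  constructor
  · rintro ⟨z, hz, rfl⟩
    exact ⟨hf.antitone hz.2, hf.antitone hz.1⟩
  · rintro ⟨h1, h2⟩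
    have hx : f x ∈ Set.Icc a b := hfr ▸ Set.mem_range_self x
    have hy : f y ∈ Set.Icc a b := hfr ▸ Set.mem_range_self y
    obtain ⟨z, rfl⟩ : w ∈ Set.range f := hfr ▸ ⟨hy.1.trans h1, h2.trans hx.2⟩
    exact ⟨z, ⟨hf.le_iff_ge.1 h2, hf.le_iff_ge.1 h1⟩, rfl⟩

/-- An increasing parametrization of `[x, y]` by `L`. -/
def IncreasingParam (f : L → L) (x y : L) : Prop := StrictMono f ∧ Set.range f = Set.Icc x y

/-- A decreasing parametrization of `[x, y]` by `L`. -/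
def DecreasingParam (f : L → L) (x y : L) : Prop := StrictAnti f ∧ Set.range f = Set.Icc x y

theorem DecreasingParam.comp_decreasing {f g : L → L} {a b x y : L} (hf : DecreasingParam f a b)
    (hg : DecreasingParam g x y) : IncreasingParam (f ∘ g) (f y) (f x) :=
  ⟨hf.1.comp hg.1, range_comp_of_strictAnti hf.1 hf.2 hg.2⟩

theorem exists_lift {f g : L → L} {x y : L} (hf : Set.range f = Set.Icc x y)
    (hg : Set.range g = Set.Icc x y) : ∃ k : L → L, ∀ z, f (k z) = g z := by
  have : ∀ z, ∃ w, f w = g z := fun z => by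
    have : g z ∈ Set.range f := by rw [hf, ← hg]; exact Set.mem_range_self z
    exact this
  exact ⟨fun z => (this z).choose, fun z => (this z).choose_spec⟩

variable [BoundedOrder L]

theorem IncreasingParam.bot {f : L → L} {x y : L} (h : IncreasingParam f x y) : f ⊥ = x := by
  have h1 : f ⊥ ∈ Set.Icc x y := h.2 ▸ Set.mem_range_self _
  obtain ⟨z, hz⟩ : x ∈ Set.range f := h.2 ▸ ⟨le_rfl, h1.1.trans h1.2⟩
  exact le_antisymm (hz ▸ h.1.monotone bot_le) h1.1

theorem IncreasingParam.top {f : L → L} {x y : L} (h : IncreasingParam f x y) : f ⊤ = y := by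
  have h1 : f ⊥ ∈ Set.Icc x y := h.2 ▸ Set.mem_range_self _
  have h2 : f ⊤ ∈ Set.Icc x y := h.2 ▸ Set.mem_range_self _
  obtain ⟨z, hz⟩ : y ∈ Set.range f := h.2 ▸ ⟨h1.1.trans h1.2, le_rfl⟩
  exact le_antisymm h2.2 (hz ▸ h.1.monotone le_top)

theorem DecreasingParam.bot {f : L → L} {x y : L} (h : DecreasingParam f x y) : f ⊥ = y := by
  have h1 : f ⊥ ∈ Set.Icc x y := h.2 ▸ Set.mem_range_self _
  obtain ⟨z, hz⟩ : y ∈ Set.range f := h.2 ▸ ⟨h1.1.trans h1.2, le_rfl⟩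
  exact le_antisymm h1.2 (hz ▸ h.1.antitone bot_le)

theorem DecreasingParam.top {f : L → L} {x y : L} (h : DecreasingParam f x y) : f ⊤ = x := by
  have h1 : f ⊥ ∈ Set.Icc x y := h.2 ▸ Set.mem_range_self _
  have h2 : f ⊤ ∈ Set.Icc x y := h.2 ▸ Set.mem_range_self _
  obtain ⟨z, hz⟩ : x ∈ Set.range f := h.2 ▸ ⟨le_rfl, h1.1.trans h1.2⟩
  exact le_antisymm (hz ▸ h.1.antitone le_top) h2.1

/-- An interval with parametrizations of both kinds makes `L` anti-isomorphic to itself. -/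
theorem exists_reversal {f g : L → L} {x y : L} (hf : IncreasingParam f x y)
    (hg : DecreasingParam g x y) : ∃ r : L → L, DecreasingParam r ⊥ ⊤ := by
  obtain ⟨k, hk⟩ := exists_lift hf.2 hg.2
  refine ⟨k, fun a b h => ?_, ?_⟩
  · rw [← hf.1.lt_iff_lt, hk, hk]
    exact hg.1 h
  · rw [Set.Icc_bot_top, Set.eq_univ_iff_forall]
    intro w
    have : f w ∈ Set.range g := by rw [hg.2, ← hf.2]; exact Set.mem_range_self w
    obtain ⟨z, hz⟩ := this
    exact ⟨z, hf.1.injective (by rw [hk, hz])⟩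

/-- If `g` and `k` parametrize the two halves of `[x, z]` in opposite directions, then exchanging
the two halves reverses `[x, z]`. -/
theorem exists_reversal_of_halves {f g k : L → L} {x y z : L} (hxy : x ≤ y) (hyz : y ≤ z)
    (hfr : Set.range f = Set.Icc x z)
    (hf : StrictMono f ∨ StrictAnti f) (hopp : StrictMono g ∧ StrictAnti k ∨
      StrictAnti g ∧ StrictMono k)
    (hgr : Set.range g = Set.Icc x y) (hkr : Set.range k = Set.Icc y z)
    (hgk : ∀ a, g a = y ↔ k a = y) :
    ∃ r : L → L, DecreasingParam r ⊥ ⊤ := by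
  classical
  have hginj : Function.Injective g := by
    rcases hopp with h | h
    exacts [h.1.injective, h.1.injective]
  have hkinj : Function.Injective k := by
    rcases hopp with h | h
    exacts [h.2.injective, h.2.injective]
  have hgm : ∀ a, x ≤ g a ∧ g a ≤ y := fun a => by
    have : g a ∈ Set.Icc x y := hgr ▸ Set.mem_range_self a
    exact this
  have hkm : ∀ a, y ≤ k a ∧ k a ≤ z := fun a => by
    have : k a ∈ Set.Icc y z := hkr ▸ Set.mem_range_self a
    exact this
  have hlr : ∀ w, x ≤ w → w ≤ z → (∃ a, w = g a) ∨ ∃ a, w = k a := by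
    intro w h1 h2
    rcases le_total w y with h | h
    · have : w ∈ Set.range g := hgr ▸ ⟨h1, h⟩
      obtain ⟨a, rfl⟩ := this
      exact Or.inl ⟨a, rfl⟩
    · have : w ∈ Set.range k := hkr ▸ ⟨h, h2⟩
      obtain ⟨a, rfl⟩ := this
      exact Or.inr ⟨a, rfl⟩
  have hgk' : ∀ a b, g a = k b → a = b := fun a b h => by
    have h1 : g a = y := le_antisymm (hgm a).2 (h ▸ (hkm b).1)
    exact hkinj (((hgk a).1 h1).trans (h1.symm.trans h))
  -- the exchange of the halves, first on `[x, z]`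
  let s : L → L := fun w => if h : ∃ a, w = g a then k h.choose else
    if h : ∃ a, w = k a then g h.choose else w
  have sg : ∀ a, s (g a) = k a := fun a => by
    have h : ∃ b, g a = g b := ⟨a, rfl⟩
    have e : h.choose = a := (hginj h.choose_spec).symm
    simp only [s, dif_pos h, e]
  have sk : ∀ a, s (k a) = g a := fun a => by
    by_cases h : ∃ b, k a = g b
    · obtain ⟨b, hb⟩ := h
      obtain rfl := hgk' b a hb.symm
      rw [hb, sg, hb]
    · have h' : ∃ b, k a = k b := ⟨a, rfl⟩
      have e : h'.choose = a := (hkinj h'.choose_spec).symm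
      simp only [s, dif_neg h, dif_pos h', e]
  have hs : ∀ v w, x ≤ v → v < w → w ≤ z → s w < s v := by
    intro v w hv hvw hw
    rcases hlr v hv (hvw.le.trans hw) with ⟨a, rfl⟩ | ⟨a, rfl⟩ <;>
      rcases hlr w (hv.trans hvw.le) hw with ⟨b, rfl⟩ | ⟨b, rfl⟩
    · rw [sg, sg]
      rcases hopp with h | h
      · exact h.2 (h.1.lt_iff_lt.1 hvw)
      · exact h.2 (h.1.lt_iff_gt.1 hvw)
    · rw [sg, sk]
      refine lt_of_le_of_ne ((hgm b).2.trans (hkm a).1) fun h => ?_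
      obtain rfl := hgk' _ _ h
      exact hvw.ne h
    · exact absurd ((hgm b).2.trans (hkm a).1) hvw.not_ge
    · rw [sk, sk]
      rcases hopp with h | h
      · exact h.1 (h.2.lt_iff_gt.1 hvw)
      · exact h.1 (h.2.lt_iff_lt.1 hvw)
  have hsm : ∀ w, x ≤ w → w ≤ z → x ≤ s w ∧ s w ≤ z ∧ s (s w) = w := by
    intro w h1 h2
    rcases hlr w h1 h2 with ⟨a, rfl⟩ | ⟨a, rfl⟩
    · rw [sg, sk]
      exact ⟨hxy.trans (hkm a).1, (hkm a).2, rfl⟩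
    · rw [sk, sg]
      exact ⟨(hgm a).1, (hgm a).2.trans hyz, rfl⟩
  have hfm : ∀ a, x ≤ f a ∧ f a ≤ z := fun a => by
    have : f a ∈ Set.Icc x z := hfr ▸ Set.mem_range_self a
    exact this
  have hsf : Set.range (fun a => s (f a)) = Set.Icc x z := by
    ext w
    constructor
    · rintro ⟨a, rfl⟩
      obtain ⟨h1, h2, -⟩ := hsm _ (hfm a).1 (hfm a).2
      exact ⟨h1, h2⟩
    · rintro ⟨h1, h2⟩
      obtain ⟨h3, h4, h5⟩ := hsm w h1 h2
      have : s w ∈ Set.range f := hfr ▸ ⟨h3, h4⟩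
      obtain ⟨a, ha⟩ := this
      exact ⟨a, by simp only [ha, h5]⟩
  rcases hf with hf | hf
  · exact exists_reversal ⟨hf, hfr⟩
      ⟨fun a b h => hs _ _ (hfm a).1 (hf h) (hfm b).2, hsf⟩
  · exact exists_reversal (f := fun a => s (f a))
      ⟨fun a b h => hs _ _ (hfm b).1 (hf h) (hfm a).2, hsf⟩ ⟨hf, hfr⟩

/-- If every nondegenerate closed interval is isomorphic or anti-isomorphic to `L`, then every one
is isomorphic to `L`. If `L` is anti-isomorphic to itself this is plain. Otherwise adjacent
intervals are of the same kind, for a union of two intervals of opposite kinds is anti-isomorphic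
to itself; hence all proper intervals are of one kind, and it cannot be the decreasing one, as the
proper subintervals of a decreasing one would be increasing. -/
theorem exists_increasingParam [DenselyOrdered L]
    (h : ∀ x y : L, x < y → (∃ f, IncreasingParam f x y) ∨ ∃ f, DecreasingParam f x y)
    {x y : L} (hxy : x < y) : ∃ f, IncreasingParam f x y := by
  by_cases hr : ∃ r : L → L, DecreasingParam r ⊥ ⊤
  · obtain ⟨r, hr⟩ := hr
    rcases h x y hxy with hi | ⟨f, hf⟩
    · exact hi
    · refine ⟨f ∘ r, ?_⟩
      have := hf.comp_decreasing hr
      rwa [hf.bot, hf.top] at this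
  · have hex : ∀ x y : L, (∃ f, IncreasingParam f x y) → (∃ f, DecreasingParam f x y) → False := by
      rintro x y ⟨f, hf⟩ ⟨g, hg⟩
      exact hr (exists_reversal hf hg)
    have hfull : ∀ x y : L, x < y → ∃ f : L → L, Set.range f = Set.Icc x y ∧
        (StrictMono f ∨ StrictAnti f) := by
      intro x y hxy
      rcases h x y hxy with ⟨f, hf⟩ | ⟨f, hf⟩
      exacts [⟨f, hf.2, Or.inl hf.1⟩, ⟨f, hf.2, Or.inr hf.1⟩]
    have adj1 : ∀ x y z : L, x < y → y < z → (∃ f, IncreasingParam f x y) →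
        (∃ f, IncreasingParam f y z) := by
      rintro x y z hxy hyz ⟨g, hg⟩
      refine (h y z hyz).resolve_right ?_
      rintro ⟨k, hk⟩
      obtain ⟨f, hfr, hf⟩ := hfull x z (hxy.trans hyz)
      exact hr (exists_reversal_of_halves hxy.le hyz.le hfr hf (Or.inl ⟨hg.1, hk.1⟩) hg.2 hk.2
        fun a => by
          rw [← hg.top, hg.1.injective.eq_iff, hg.top, ← hk.top, hk.1.injective.eq_iff])
    have adj2 : ∀ x y z : L, x < y → y < z → (∃ f, DecreasingParam f x y) →
        (∃ f, DecreasingParam f y z) := by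
      rintro x y z hxy hyz ⟨g, hg⟩
      refine (h y z hyz).resolve_left ?_
      rintro ⟨k, hk⟩
      obtain ⟨f, hfr, hf⟩ := hfull x z (hxy.trans hyz)
      exact hr (exists_reversal_of_halves hxy.le hyz.le hfr hf (Or.inr ⟨hg.1, hk.1⟩) hg.2 hk.2
        fun a => by
          rw [← hg.bot, hg.1.injective.eq_iff, hg.bot, ← hk.bot, hk.1.injective.eq_iff])
    by_contra hno
    have hdec : ∃ f, DecreasingParam f x y := (h x y hxy).resolve_left hno
    have huniv : ∃ f : L → L, IncreasingParam f ⊥ ⊤ :=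
      ⟨id, strictMono_id, by rw [Set.range_id, Set.Icc_bot_top]⟩
    -- the converse direction of `adj2`, by contraposition from `adj1`
    have back : ∀ x y z : L, x < y → y < z → (∃ f, DecreasingParam f y z) →
        (∃ f, DecreasingParam f x y) := fun x y z hxy hyz hd =>
      (h x y hxy).resolve_left fun hi => hex _ _ (adj1 x y z hxy hyz hi) hd
    obtain ⟨a, ha, ha', had⟩ : ∃ a : L, ⊥ < a ∧ a < ⊤ ∧ ∃ f, DecreasingParam f ⊥ a := by
      rcases (bot_le : ⊥ ≤ x).eq_or_lt with rfl | hx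
      · refine ⟨y, hxy, lt_of_le_of_ne le_top ?_, hdec⟩
        rintro rfl
        exact hno huniv
      · exact ⟨x, hx, hxy.trans_le le_top, back _ _ _ hx hxy hdec⟩
    obtain ⟨f, hf⟩ := had
    -- the anti-isomorphism `f` of `L` onto `[⊥, a]` takes `[c', ⊤]` to `[⊥, f c']`; both turn out
    -- to be decreasing, so that `[⊥, f c']` is increasing as well
    obtain ⟨c, hc, hca⟩ := exists_between ha
    have hac : ∃ k, DecreasingParam k c a := by
      have h1 := adj2 _ _ _ ha ha' ⟨f, hf⟩
      exact back _ _ _ hca ha' h1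
    have h0c := back _ _ _ hc hca hac
    obtain ⟨c', rfl⟩ : c ∈ Set.range f := hf.2 ▸ ⟨hc.le, hca.le⟩
    have hc't : c' < ⊤ := lt_of_le_of_ne le_top fun e => by
      rw [e, hf.top] at hc; exact lt_irrefl _ hc
    have hc'b : ⊥ < c' := lt_of_le_of_ne bot_le fun e => by
      rw [← e, hf.bot] at hca; exact lt_irrefl _ hca
    -- from `[⊥, a]` to `[c', ⊤]` by adjacent intervals, through a point `d` before `c'` and `a`
    have hc'd : ∃ k, DecreasingParam k c' ⊤ := by
      obtain ⟨d, hd, hd'⟩ := exists_between (lt_min hc'b ha)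
      have hdc' := hd'.trans_le (min_le_left _ _)
      have hda := hd'.trans_le (min_le_right _ _)
      have h1 : ∃ k, DecreasingParam k d a :=
        back _ _ _ hda ha' (adj2 _ _ _ ha ha' ⟨f, hf⟩)
      have h2 := back _ _ _ hd hda h1
      exact adj2 _ _ _ hdc' hc't (adj2 _ _ _ hd hdc' h2)
    obtain ⟨k, hk⟩ := hc'd
    refine hex ⊥ (f c') ⟨f ∘ k, ?_⟩ h0c
    have := hf.comp_decreasing hk
    rwa [hf.top] at this

/-- A compact linear order with the order topology is complete. -/
theorem exists_isLUB_of_compactSpace [TopologicalSpace L] [OrderTopology L] [CompactSpace L]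
    (s : Set L) : ∃ b, IsLUB s b := by
  rcases s.eq_empty_or_nonempty with rfl | hs
  · exact ⟨⊥, isLUB_empty⟩
  · obtain ⟨b, hb⟩ := isClosed_closure.isCompact.exists_isLUB hs.closure
    exact ⟨b, by rw [IsLUB, ← upperBounds_closure]; exact hb.2⟩

/-- The conditionally complete linear order on a compact linear order, with the given order. -/
noncomputable abbrev conditionallyCompleteOfCompact (L : Type u) [inst : LinearOrder L]
    [BoundedOrder L] [TopologicalSpace L] [OrderTopology L] [CompactSpace L] :
    ConditionallyCompleteLinearOrder L :=
  letI : SupSet L := ⟨fun s => (exists_isLUB_of_compactSpace s).choose⟩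
  { inst, conditionallyCompleteLatticeOfLatticeOfsSup L
      (fun s _ _ => (exists_isLUB_of_compactSpace s).choose_spec) with
    csSup_of_not_bddAbove := fun s h => absurd (OrderTop.bddAbove s) h
    csInf_of_not_bddBelow := fun s h => absurd (OrderBot.bddBelow s) h }

/-- A homeomorphism of `L` onto `[x, y]` is strictly monotone, so `exists_increasingParam`
applies. -/
theorem IsOrderHomogeneous.exists_increasingParam [TopologicalSpace L]
    (hL : IsOrderedContinuum L) (hom : IsOrderHomogeneous L) {x y : L} (hxy : x < y) :
    ∃ f, IncreasingParam f x y := by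
  have := hL.orderTopology
  have := hL.compactSpace
  have := hL.connectedSpace
  have hd : DenselyOrdered L := denselyOrdered_of_preconnectedSpace
  refine LongSolenoid.exists_increasingParam (fun x y hxy => ?_) hxy
  obtain ⟨e⟩ := hom x y hxy
  let f : L → L := fun z => e z
  have hfr : Set.range f = Set.Icc x y := by
    rw [show f = Subtype.val ∘ e from rfl, Set.range_comp, e.surjective.range_eq, Set.image_univ,
      Subtype.range_coe]
  have hf : StrictMono f ∨ StrictAnti f := by
    let := conditionallyCompleteOfCompact L
    exact (continuous_subtype_val.comp e.continuous).strictMono_of_inj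
      (Subtype.val_injective.comp e.injective)
  exact hf.imp (fun h => ⟨f, h, hfr⟩) fun h => ⟨f, h, hfr⟩

/-- Exchanging the two halves `[⊥, t]` and `[t, ⊤]` of `L` by mutually inverse increasing maps
`U` and `V`, extended to all of `L`. -/
theorem exists_exchange [TopologicalSpace L]
    (hL : IsOrderedContinuum L) (hom : IsOrderHomogeneous L) {t : L} (h0 : ⊥ < t) (h1 : t < ⊤) :
    ∃ U V : L → L, Continuous U ∧ Continuous V ∧ U ⊥ = t ∧ U t = ⊤ ∧ V t = ⊥ ∧ V ⊤ = t ∧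
      (∀ y ≤ t, t ≤ U y ∧ V (U y) = y) ∧ (∀ y, t ≤ y → V y ≤ t ∧ U (V y) = y) := by
  have := hL.orderTopology
  obtain ⟨f, hf⟩ := hom.exists_increasingParam hL h0
  obtain ⟨g, hg⟩ := hom.exists_increasingParam hL h1
  let ef : L ≃o Set.Icc ⊥ t := (hf.1.orderIso f).trans (OrderIso.setCongr _ _ hf.2)
  let eg : L ≃o Set.Icc t ⊤ := (hg.1.orderIso g).trans (OrderIso.setCongr _ _ hg.2)
  let e : Set.Icc ⊥ t ≃o Set.Icc t ⊤ := ef.symm.trans eg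
  let U : L → L := fun y => e (Set.projIcc ⊥ t bot_le y)
  let V : L → L := fun y => e.symm (Set.projIcc t ⊤ le_top y)
  have hU : ∀ y (h : y ≤ t), U y = e ⟨y, bot_le, h⟩ := fun y h => by
    simp only [U]
    rw [Set.projIcc_of_mem (a := ⊥) (b := t) bot_le ⟨bot_le, h⟩]
  have hV : ∀ y (h : t ≤ y), V y = e.symm ⟨y, h, le_top⟩ := fun y h => by
    simp only [V]
    rw [Set.projIcc_of_mem (a := t) (b := ⊤) le_top ⟨h, le_top⟩]
  have h1 : ∀ y ≤ t, t ≤ U y ∧ V (U y) = y := fun y h => by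
    have h' : t ≤ U y := (e _).2.1
    refine ⟨h', ?_⟩
    rw [hV _ h']
    simp [hU y h]
  have h2 : ∀ y, t ≤ y → V y ≤ t ∧ U (V y) = y := fun y h => by
    have h' : V y ≤ t := (e.symm _).2.2
    refine ⟨h', ?_⟩
    rw [hU _ h']
    simp [hV y h]
  have hb : U ⊥ = t := by
    refine le_antisymm ?_ (h1 ⊥ bot_le).1
    have h3 := h2 t le_rfl
    rw [← h3.2, hU _ h3.1, hU _ bot_le]
    exact e.monotone (Subtype.mk_le_mk.2 bot_le)
  have ht : V ⊤ = t := by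
    refine le_antisymm (h2 ⊤ le_top).1 ?_
    have h3 := h1 t le_rfl
    rw [← h3.2, hV _ h3.1, hV _ le_top]
    exact e.symm.monotone (Subtype.mk_le_mk.2 le_top)
  refine ⟨U, V, ?_, ?_, hb, ?_, ?_, ht, h1, h2⟩
  · exact continuous_subtype_val.comp (e.toHomeomorph.continuous.comp continuous_projIcc)
  · exact continuous_subtype_val.comp (e.toHomeomorph.symm.continuous.comp continuous_projIcc)
  · rw [← ht, (h2 ⊤ le_top).2]
  · rw [← hb, (h1 ⊥ bot_le).2]

end Order

/-! ### Circles made of copies of an ordered continuum -/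

section Circ

variable {L : Type u} [LinearOrder L] [BoundedOrder L]

/-- A map on the circle given by a periodic sequence of maps on `L` that fit together at the end
points. -/
def circLift {n : ℕ} {Y : Type*} (φ : ℕ → L → Y) (hper : ∀ i x, φ (i % n) x = φ i x)
    (hglue : ∀ i, φ i ⊤ = φ (i + 1) ⊥) : Circ L n → Y :=
  Quot.lift (fun q => φ q.1 q.2) (by
    rintro _ _ ⟨i, j, h⟩
    simp only [h, hper, hglue])

theorem continuous_circLift [TopologicalSpace L] {n : ℕ} {Y : Type*} [TopologicalSpace Y]
    (φ : ℕ → L → Y) (hper : ∀ i x, φ (i % n) x = φ i x)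
    (hglue : ∀ i, φ i ⊤ = φ (i + 1) ⊥) (hφ : ∀ i, Continuous (φ i)) :
    Continuous (circLift φ hper hglue : Circ L n → Y) :=
  continuous_quot_lift _ (continuous_prod_of_discrete_left.2 fun i => hφ i)

/-- The point `x` of the copy of `L` with number `i` modulo `n`. -/
def pt (n : ℕ) [NeZero n] (i : ℕ) (x : L) : Circ L n := Quot.mk _ (Fin.ofNat n i, x)

section

variable {n : ℕ} [NeZero n]

theorem pt_congr {i j : ℕ} (h : i ≡ j [MOD n]) (x : L) : pt n i x = pt n j x := by
  have : Fin.ofNat n i = Fin.ofNat n j := Fin.ext h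
  rw [pt, pt, this]

theorem pt_top (i : ℕ) : pt n i (⊤ : L) = pt n (i + 1) ⊥ :=
  Quot.sound (Glue.mk _ _ (by simp [Fin.ofNat]))

theorem exists_eq_pt (c : Circ L n) : ∃ i < n, ∃ x, c = pt n i x := by
  obtain ⟨⟨i, x⟩, rfl⟩ := Quot.exists_rep c
  refine ⟨i, i.2, x, ?_⟩
  rw [pt, Fin.ofNat_val_eq_self]

theorem bond_pt (m n : ℕ) [NeZero n] [NeZero (m * n)] (i : ℕ) (x : L) :
    bond L m n (pt (m * n) i x) = pt n i x := by
  have : (Fin.ofNat (m * n) i).modNat = Fin.ofNat n i :=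
    Fin.ext (by simp [Fin.modNat, Fin.ofNat])
  change Quot.mk _ ((Fin.ofNat (m * n) i).modNat, x) = pt n i x
  rw [this, pt]

theorem circLift_pt {Y : Type*} (φ : ℕ → L → Y) (hper : ∀ i x, φ (i % n) x = φ i x)
    (hglue : ∀ i, φ i ⊤ = φ (i + 1) ⊥) (i : ℕ) (x : L) :
    circLift φ hper hglue (pt n i x) = φ i x := hper i x

/-- A normal form for points of the circle, in which the number of the copy is less than `n` and
the last point of a copy is replaced by the first point of the next one. -/
noncomputable def normalForm [Nontrivial L] : Circ L n → ℕ × L :=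
  circLift (fun i x => if x = ⊤ then ((i + 1) % n, ⊥) else (i % n, x))
    (fun i x => by simp) (fun i => by simp)

theorem normalForm_pt_top [Nontrivial L] (i : ℕ) :
    normalForm (pt n i (⊤ : L)) = ((i + 1) % n, ⊥) :=
  (circLift_pt _ _ _ _ _).trans (if_pos rfl)

theorem normalForm_pt [Nontrivial L] (i : ℕ) {x : L} (hx : x ≠ ⊤) :
    normalForm (pt n i x) = (i % n, x) :=
  (circLift_pt _ _ _ _ _).trans (if_neg hx)

theorem pt_bot_eq_pt_bot [Nontrivial L] {i j : ℕ} :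
    pt n i (⊥ : L) = pt n j ⊥ ↔ i ≡ j [MOD n] := by
  refine ⟨fun h => ?_, fun h => pt_congr h _⟩
  have := congrArg normalForm h
  rw [normalForm_pt _ bot_ne_top, normalForm_pt _ bot_ne_top] at this
  exact congrArg Prod.fst this

theorem eq_of_pt_eq_pt_of_ne [Nontrivial L] {i j : ℕ} {x y : L} (hx : x ≠ ⊤) (hy : y ≠ ⊤)
    (h : pt n i x = pt n j y) : x = y := by
  have := congrArg normalForm h
  rw [normalForm_pt _ hx, normalForm_pt _ hy] at this
  exact congrArg Prod.snd this

theorem eq_bot_or_eq_top_of_pt_eq_pt_bot [Nontrivial L] {i j : ℕ} {x : L}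
    (h : pt n i x = pt n j ⊥) : x = ⊥ ∨ x = ⊤ := by
  by_cases hx : x = ⊤
  · exact Or.inr hx
  · exact Or.inl (eq_of_pt_eq_pt_of_ne hx bot_ne_top h)

/-- If the circle of `m * n` copies is cut at the points over the base point of the circle of `n`
copies, then each of the `m` arcs consists of `n` consecutive copies. -/
theorem normalForm_div [Nontrivial L] {m n : ℕ} [NeZero n] [NeZero (m * n)] {i : ℕ} {x : L}
    (h : pt n i x ≠ pt n 0 ⊥) : (normalForm (pt (m * n) i x)).1 / n = i % (m * n) / n := by
  by_cases hx : x = ⊤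
  · subst hx
    rw [normalForm_pt_top]
    rw [pt_top, Ne, pt_bot_eq_pt_bot, Nat.modEq_zero_iff_dvd] at h
    have h1 : ¬ n ∣ i % (m * n) + 1 := by
      intro hd
      apply h
      have := (Nat.mod_modEq i (m * n)).of_dvd (Dvd.intro_left m rfl : n ∣ m * n)
      exact ((this.add_right 1).dvd_iff dvd_rfl).1 hd
    have h2 : i % (m * n) + 1 < m * n := by
      refine lt_of_le_of_ne (Nat.mod_lt _ (NeZero.pos _)) fun e => h1 ?_
      rw [e]
      exact Dvd.intro_left m rfl
    have h3 : (i + 1) % (m * n) = i % (m * n) + 1 := by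
      rw [← Nat.mod_add_mod, Nat.mod_eq_of_lt h2]
    simp only [h3]
    rw [Nat.succ_div, if_neg h1, add_zero]
  · rw [normalForm_pt _ hx]

/-- The rotation of the circle by `c` copies. -/
def rotation (n : ℕ) [NeZero n] (c : ℕ) : Circ L n → Circ L n :=
  circLift (fun i x => pt n (i + c) x)
    (fun i x => pt_congr ((Nat.mod_modEq i n).add_right c) x)
    (fun i => by rw [pt_top, add_right_comm])

theorem rotation_pt (c i : ℕ) (x : L) : rotation n c (pt n i x) = pt n (i + c) x :=
  circLift_pt _ _ _ _ _

theorem rotation_rotation_of_add {c d : ℕ} (h : c + d ≡ 0 [MOD n]) (z : Circ L n) :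
    rotation n d (rotation n c z) = z := by
  obtain ⟨i, -, x, rfl⟩ := exists_eq_pt z
  rw [rotation_pt, rotation_pt, add_assoc]
  exact pt_congr (h.add_left i) x

section Topology

variable [TopologicalSpace L]

theorem continuous_pt (i : ℕ) : Continuous (pt n i : L → Circ L n) :=
  continuous_quot_mk.comp (by fun_prop)

theorem isOpen_circ_iff {U : Set (Circ L n)} :
    IsOpen U ↔ ∀ i, IsOpen {x : L | pt n i x ∈ U} := by
  refine ⟨fun h i => h.preimage (continuous_pt i), fun h => ?_⟩
  rw [← isQuotientMap_quot_mk.isOpen_preimage]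
  refine continuous_Prop.1 (continuous_prod_of_discrete_left.2 fun i => continuous_Prop.2 ?_)
  convert h i using 3
  rw [pt, Fin.ofNat_val_eq_self]

/-- Only end points are identified, so two different fibres of the quotient map, each enlarged by
the other end points, can be separated by a continuous function, which then descends. -/
instance [Nontrivial L] [T2Space L] [CompactSpace L] : T2Space (Circ L n) := by
  classical
  -- the point itself where nothing is identified, and `none` at all end points
  let g : Circ L n → Option (Fin n × L) :=
    Quot.lift (fun a => if a.2 = ⊥ ∨ a.2 = ⊤ then none else some a) (by
      rintro _ _ ⟨i, j, h⟩
      simp)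
  have hg : ∀ a b : Fin n × L, (Quot.mk _ a : Circ L n) = Quot.mk _ b →
      a = b ∨ (a.2 = ⊥ ∨ a.2 = ⊤) ∧ (b.2 = ⊥ ∨ b.2 = ⊤) := by
    intro a b h
    have h' : (if a.2 = ⊥ ∨ a.2 = ⊤ then none else some a) =
      if b.2 = ⊥ ∨ b.2 = ⊤ then none else some b := congrArg g h
    split_ifs at h' with h1 h2 h3
    · exact Or.inr ⟨h1, h2⟩
    · exact Or.inl (Option.some.inj h')
  let V : Set (Fin n × L) := {a | a.2 = ⊥ ∨ a.2 = ⊤}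
  have hV : V.Finite := by
    refine (Set.finite_univ.prod (Set.toFinite {(⊥ : L), ⊤})).subset (t := V) fun a ha => ?_
    exact ⟨trivial, ha⟩
  have hfib : ∀ c : Circ L n, ({a | (Quot.mk _ a : Circ L n) = c} : Set (Fin n × L)).Finite := by
    intro c
    obtain ⟨b, rfl⟩ := Quot.exists_rep c
    refine (hV.insert b).subset fun a ha => ?_
    rcases hg a b ha with rfl | h
    exacts [Or.inl rfl, Or.inr h.1]
  refine ⟨fun c d hcd => ?_⟩
  obtain ⟨f, hf0, hf1, -⟩ := exists_continuous_zero_one_of_isClosed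
    (s := {a | (Quot.mk _ a : Circ L n) = c})
    (t := {a | (Quot.mk _ a : Circ L n) = d} ∪ {a ∈ V | (Quot.mk _ a : Circ L n) ≠ c})
    (hfib c).isClosed ((hfib d).union (hV.subset fun a ha => ha.1)).isClosed (by
      refine Set.disjoint_left.2 fun a ha => ?_
      rintro (hb | hb)
      · exact hcd (ha.symm.trans hb)
      · exact hb.2 ha)
  have hend : ∀ a ∈ V, ∀ b ∈ V, (Quot.mk _ a : Circ L n) = Quot.mk _ b → f a = f b := by
    intro a ha b hb hab
    by_cases h : (Quot.mk _ a : Circ L n) = c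
    · rw [hf0 h, hf0 (show _ = c from hab ▸ h)]
      rfl
    · rw [hf1 (Or.inr ⟨ha, h⟩), hf1 (Or.inr ⟨hb, fun e => h (hab.trans e)⟩)]
      rfl
  let F : Circ L n → ℝ := Quot.lift f (by
    intro a b hab
    have h := Quot.sound hab
    obtain ⟨i, j, -⟩ := hab
    exact hend _ (Or.inr rfl) _ (Or.inl rfl) h)
  have hF : Continuous F := continuous_quot_lift _ f.continuous
  refine separated_by_continuous hF ?_
  obtain ⟨a, rfl⟩ := Quot.exists_rep c
  obtain ⟨b, rfl⟩ := Quot.exists_rep d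
  change f a ≠ f b
  rw [hf0 rfl, hf1 (Or.inl rfl)]
  exact zero_ne_one

theorem preconnectedSpace_circ [PreconnectedSpace L] : PreconnectedSpace (Circ L n) := by
  have hpre : ∀ i, IsPreconnected (Set.range (pt n i : L → Circ L n)) :=
    fun i => isPreconnected_range (continuous_pt i)
  have key : ∀ i, ∃ s : Set (Circ L n), IsPreconnected s ∧
      ∀ j ≤ i, Set.range (pt n j : L → Circ L n) ⊆ s := by
    intro i
    induction i with
    | zero => exact ⟨_, hpre 0, fun j hj => by rw [Nat.le_zero.1 hj]⟩
    | succ i ih =>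
      obtain ⟨s, hs, hsub⟩ := ih
      refine ⟨s ∪ Set.range (pt n (i + 1)), hs.union (pt n i ⊤) (hsub i le_rfl ⟨⊤, rfl⟩)
        ⟨⊥, (pt_top i).symm⟩ (hpre _), fun j hj => ?_⟩
      rcases hj.eq_or_lt with rfl | h
      · exact Set.subset_union_right
      · exact (hsub j (by omega)).trans Set.subset_union_left
  obtain ⟨s, hs, hsub⟩ := key n
  refine ⟨?_⟩
  convert hs
  refine (Set.eq_univ_of_forall fun c => ?_).symm
  obtain ⟨i, hi, x, rfl⟩ := exists_eq_pt c
  exact hsub i hi.le ⟨x, rfl⟩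

theorem continuous_bond (m n : ℕ) : Continuous (bond L m n) :=
  continuous_quot_lift _ (continuous_quot_mk.comp
    ((continuous_of_discreteTopology (f := Fin.modNat).comp continuous_fst).prodMk
      continuous_snd))

theorem continuous_rotation (c : ℕ) : Continuous (rotation n c : Circ L n → Circ L n) :=
  continuous_circLift _ _ _ fun i => continuous_pt (i + c)

/-- The rotation of the circle by `c` copies, as a homeomorphism. -/
def rotationHomeo (n : ℕ) [NeZero n] (c : ℕ) : Circ L n ≃ₜ Circ L n where
  toFun := rotation n c
  invFun := rotation n ((n - 1) * c)
  left_inv := rotation_rotation_of_add (by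
    obtain ⟨k, hk⟩ := Nat.exists_eq_succ_of_ne_zero (NeZero.ne n)
    rw [show c + (n - 1) * c = n * c by rw [hk, Nat.succ_sub_one, Nat.succ_mul, add_comm]]
    exact Nat.modEq_zero_iff_dvd.2 (dvd_mul_right n c))
  right_inv := rotation_rotation_of_add (by
    obtain ⟨k, hk⟩ := Nat.exists_eq_succ_of_ne_zero (NeZero.ne n)
    rw [show (n - 1) * c + c = n * c by rw [hk, Nat.succ_sub_one, Nat.succ_mul]]
    exact Nat.modEq_zero_iff_dvd.2 (dvd_mul_right n c))
  continuous_toFun := continuous_rotation _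
  continuous_invFun := continuous_rotation _

theorem rotationHomeo_pt (c i : ℕ) (x : L) : rotationHomeo n c (pt n i x) = pt n (i + c) x :=
  rotation_pt _ _ _

/-- A homeomorphism of the circle that moves the beginning of every copy of `L` to the point `t`
of that copy: every half `[⊥, t]` goes to the following half `[t, ⊤]`, and this goes to the next
`[⊥, t]`. Its square is the rotation by one copy. It has the same form for all `n`, so these maps
commute with the covering maps. -/
theorem exists_halfRotation (hL : IsOrderedContinuum L) (hom : IsOrderHomogeneous L) {t : L}
    (h0 : ⊥ < t) (h1 : t < ⊤) :
    ∃ h : (n : ℕ) → [NeZero n] → Circ L n ≃ₜ Circ L n,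
      (∀ (n : ℕ) [NeZero n] (i : ℕ), h n (pt n i ⊥) = pt n i t) ∧
      ∀ (m n : ℕ) [NeZero n] [NeZero (m * n)] (z : Circ L (m * n)),
        bond L m n (h (m * n) z) = h n (bond L m n z) := by
  classical
  have := hL.orderTopology
  obtain ⟨U, V, hU, hV, U0, Ut, Vt, V1, hUV, hVU⟩ := exists_exchange hL hom h0 h1
  let φ : (n : ℕ) → [NeZero n] → ℕ → L → Circ L n := fun n _ i y =>
    if y ≤ t then pt n i (U y) else pt n (i + 1) (V y)
  have φ1 : ∀ (n : ℕ) [NeZero n] (i : ℕ) (y : L), y ≤ t → φ n i y = pt n i (U y) :=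
    fun n _ i y h => if_pos h
  have φ2 : ∀ (n : ℕ) [NeZero n] (i : ℕ) (y : L), t ≤ y → φ n i y = pt n (i + 1) (V y) := by
    intro n _ i y h
    rcases h.eq_or_lt with rfl | h
    · rw [φ1 n i _ le_rfl, Ut, Vt, pt_top]
    · exact if_neg h.not_ge
  have hper : ∀ (n : ℕ) [NeZero n] (i : ℕ) (x : L), φ n (i % n) x = φ n i x := by
    intro n _ i x
    have h : i % n ≡ i [MOD n] := Nat.mod_modEq i n
    simp only [φ]
    rw [pt_congr h, pt_congr (h.add_right 1)]
  have hglue : ∀ (n : ℕ) [NeZero n] (i : ℕ), φ n i ⊤ = φ n (i + 1) ⊥ := by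
    intro n _ i
    rw [φ2 n i ⊤ h1.le, φ1 n _ ⊥ h0.le, V1, U0]
  let g : (n : ℕ) → [NeZero n] → Circ L n → Circ L n := fun n _ =>
    circLift (φ n) (hper n) (hglue n)
  have hg : ∀ (n : ℕ) [NeZero n] (i : ℕ) (x : L), g n (pt n i x) = φ n i x :=
    fun n _ i x => circLift_pt _ _ _ i x
  have hgc : ∀ (n : ℕ) [NeZero n], Continuous (g n) := by
    intro n _
    refine continuous_circLift _ _ _ fun i => ?_
    refine Continuous.if_le ((continuous_pt i).comp hU) ((continuous_pt (i + 1)).comp hV)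
      continuous_id continuous_const fun x hx => ?_
    obtain rfl : x = t := hx
    simp only [Ut, Vt, pt_top]
  have hgg : ∀ (n : ℕ) [NeZero n] (z : Circ L n), g n (g n z) = rotation n 1 z := by
    intro n _ z
    obtain ⟨i, -, x, rfl⟩ := exists_eq_pt z
    rw [hg, rotation_pt]
    rcases le_total x t with h | h
    · rw [φ1 n i x h, hg, φ2 n i _ (hUV x h).1, (hUV x h).2]
    · rw [φ2 n i x h, hg, φ1 n _ _ (hVU x h).1, (hVU x h).2]
  have hgr : ∀ (n : ℕ) [NeZero n] (c : ℕ) (z : Circ L n),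
      g n (rotation n c z) = rotation n c (g n z) := by
    intro n _ c z
    obtain ⟨i, -, x, rfl⟩ := exists_eq_pt z
    rw [hg, rotation_pt, hg]
    rcases le_total x t with h | h
    · rw [φ1 n _ x h, φ1 n _ x h, rotation_pt]
    · rw [φ2 n _ x h, φ2 n _ x h, rotation_pt, add_right_comm]
  have hn : ∀ (n : ℕ) [NeZero n], 1 + (n - 1) ≡ 0 [MOD n] := by
    intro n _
    rw [show 1 + (n - 1) = n by have := NeZero.pos n; omega]
    exact Nat.modEq_zero_iff_dvd.2 dvd_rfl
  refine ⟨fun n _ =>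
    { toFun := g n
      invFun := fun z => rotation n (n - 1) (g n z)
      left_inv := fun z => by
        simp only [hgg]; exact rotation_rotation_of_add (hn n) z
      right_inv := fun z => by
        simp only [hgr, hgg]; exact rotation_rotation_of_add (hn n) z
      continuous_toFun := hgc n
      continuous_invFun := (continuous_rotation _).comp (hgc n) }, ?_, ?_⟩
  · intro n _ i
    change g n (pt n i ⊥) = _
    rw [hg, φ1 n _ _ h0.le, U0]
  · intro m n _ _ z
    change bond L m n (g (m * n) z) = g n (bond L m n z)
    obtain ⟨i, -, x, rfl⟩ := exists_eq_pt z
    rw [bond_pt, hg, hg]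
    rcases le_total x t with h | h
    · rw [φ1 _ _ x h, φ1 _ _ x h, bond_pt]
    · rw [φ2 _ _ x h, φ2 _ _ x h, bond_pt]

end Topology

end

end Circ

/-! ### The inverse limit -/

section Solenoid

variable {L : Type u} [LinearOrder L] [BoundedOrder L] {p : ℕ → ℕ}

theorem two_le_copies_one (hp : ∀ n, 2 ≤ p n) : 2 ≤ copies p 1 := by
  simpa [copies] using hp 0

theorem bond_copies_pt [hz : ∀ n, NeZero (copies p n)] (n i : ℕ) (x : L) :
    bond L (p n) (copies p n) (pt (copies p (n + 1)) i x) = pt (copies p n) i x :=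
  have : NeZero (p n * copies p n) := hz (n + 1)
  bond_pt (p n) (copies p n) i x

variable [TopologicalSpace L]

theorem continuous_apply_solenoid (n : ℕ) : Continuous fun s : Solenoid L p => s.1 n :=
  (continuous_apply n).comp continuous_subtype_val

/-- An open condition at one level is an open condition at every later level. -/
theorem exists_isOpen_of_le {m n : ℕ} (hmn : m ≤ n) {V : Set (Circ L (copies p m))}
    (hV : IsOpen V) : ∃ W : Set (Circ L (copies p n)), IsOpen W ∧
      ∀ s : Solenoid L p, s.1 n ∈ W ↔ s.1 m ∈ V := by
  induction n, hmn using Nat.le_induction with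
  | base => exact ⟨V, hV, fun s => Iff.rfl⟩
  | succ n hmn ih =>
    obtain ⟨W, hW, h⟩ := ih
    refine ⟨bond L (p n) (copies p n) ⁻¹' W, hW.preimage (continuous_bond _ _), fun s => ?_⟩
    change bond L (p n) (copies p n) (s.1 (n + 1)) ∈ W ↔ _
    rw [s.2 n]
    exact h s

/-- The open sets that are given by open conditions at one level form a basis. -/
theorem exists_level_of_isOpen {U : Set (Solenoid L p)} (hU : IsOpen U) {s : Solenoid L p}
    (hs : s ∈ U) : ∃ n, ∃ V : Set (Circ L (copies p n)), IsOpen V ∧ s.1 n ∈ V ∧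
      ∀ t : Solenoid L p, t.1 n ∈ V → t ∈ U := by
  obtain ⟨O, hO, rfl⟩ := isOpen_induced_iff.1 hU
  obtain ⟨I, u, hu, hI⟩ := isOpen_pi_iff.1 hO s.1 hs
  have hle : ∀ i ∈ I, i ≤ I.sup id := fun i hi => Finset.le_sup (f := id) hi
  have : ∀ i : I, ∃ W : Set (Circ L (copies p (I.sup id))), IsOpen W ∧
      ∀ s : Solenoid L p, s.1 (I.sup id) ∈ W ↔ s.1 i ∈ u i := fun i =>
    exists_isOpen_of_le (hle i i.2) (hu i i.2).1
  choose W hW hWu using this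
  refine ⟨I.sup id, ⋂ i, W i, isOpen_iInter_of_finite hW, ?_, fun t ht => hI fun i hi => ?_⟩
  · exact Set.mem_iInter.2 fun i => (hWu i s).2 (hu i i.2).2
  · exact (hWu ⟨i, hi⟩ t).1 (Set.mem_iInter.1 ht ⟨i, hi⟩)

variable [hz : ∀ n, NeZero (copies p n)]

/-- The thread in the inverse limit that consists of the points `x` of the `i`th copies. -/
def solPt (p : ℕ → ℕ) [∀ n, NeZero (copies p n)] (i : ℕ) (x : L) : Solenoid L p :=
  ⟨fun n => pt (copies p n) i x, fun n => bond_copies_pt n i x⟩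

theorem exists_apply_eq (n : ℕ) (c : Circ L (copies p n)) : ∃ s : Solenoid L p, s.1 n = c := by
  obtain ⟨i, -, x, rfl⟩ := exists_eq_pt c
  exact ⟨solPt p i x, rfl⟩

theorem apply_eq_pt_of_le {s : Solenoid L p} {m n i : ℕ} {x : L} (hmn : m ≤ n)
    (h : s.1 n = pt (copies p n) i x) : s.1 m = pt (copies p m) i x := by
  induction n, hmn using Nat.le_induction with
  | base => exact h
  | succ n hmn ih =>
    refine ih ?_
    rw [← s.2 n, h, bond_copies_pt]

theorem continuous_solPt (i : ℕ) : Continuous (solPt p i : L → Solenoid L p) :=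
  Continuous.subtype_mk (continuous_pi fun _ => continuous_pt i) _

theorem compactSpace_solenoid [Nontrivial L] [T2Space L] [CompactSpace L] :
    CompactSpace (Solenoid L p) := by
  have h : IsClosed {s : (n : ℕ) → Circ L (copies p n) |
      ∀ n, bond L (p n) (copies p n) (s (n + 1)) = s n} := by
    rw [Set.ofPred_forall]
    exact isClosed_iInter fun n =>
      isClosed_eq ((continuous_bond _ _).comp (continuous_apply (n + 1))) (continuous_apply n)
  exact isCompact_iff_compactSpace.1 h.isCompact

/-- An open cover of the inverse limit is refined by an open cover of a circle. -/
theorem exists_level_of_cover [CompactSpace (Solenoid L p)] (M : ℕ) {𝒰 : Set (Set (Solenoid L p))}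
    (ho : ∀ U ∈ 𝒰, IsOpen U) (hc : ⋃₀ 𝒰 = Set.univ) :
    ∃ N ≥ M, ∀ c : Circ L (copies p N), ∃ V, IsOpen V ∧ c ∈ V ∧
      ∃ U ∈ 𝒰, ∀ s : Solenoid L p, s.1 N ∈ V → s ∈ U := by
  have : ∀ s : Solenoid L p, ∃ n, ∃ V : Set (Circ L (copies p n)), IsOpen V ∧ s.1 n ∈ V ∧
      ∃ U ∈ 𝒰, ∀ t : Solenoid L p, t.1 n ∈ V → t ∈ U := by
    intro s
    obtain ⟨U, hU, hs⟩ := Set.mem_sUnion.1 (hc ▸ Set.mem_univ s)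
    obtain ⟨n, V, hV, hsV, h⟩ := exists_level_of_isOpen (ho U hU) hs
    exact ⟨n, V, hV, hsV, U, hU, h⟩
  choose n V hV hsV U hU h using this
  obtain ⟨t, ht⟩ := isCompact_univ.elim_finite_subcover
    (fun s : Solenoid L p => {r : Solenoid L p | r.1 (n s) ∈ V s})
    (fun s => (hV s).preimage (continuous_apply_solenoid _))
    (fun s _ => Set.mem_iUnion.2 ⟨s, hsV s⟩)
  refine ⟨max M (t.sup n), le_max_left _ _, fun c => ?_⟩
  obtain ⟨r, rfl⟩ := exists_apply_eq _ c
  obtain ⟨s, hs, hr⟩ := Set.mem_iUnion₂.1 (ht (Set.mem_univ r))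
  obtain ⟨W, hW, hWs⟩ := exists_isOpen_of_le
    ((Finset.le_sup hs).trans (le_max_right M (t.sup n))) (hV s)
  exact ⟨W, hW, (hWs r).2 hr, U s, hU s, fun q hq => h s q ((hWs q).1 hq)⟩

theorem preconnectedSpace_solenoid [PreconnectedSpace L] [CompactSpace (Solenoid L p)] :
    PreconnectedSpace (Solenoid L p) := by
  refine preconnectedSpace_iff_clopen.2 fun A hA => ?_
  obtain ⟨N, -, hN⟩ := exists_level_of_cover 0 (𝒰 := {A, Aᶜ})
    (by rintro U (rfl | rfl); exacts [hA.2, hA.1.isOpen_compl]) (by simp)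
  have : PreconnectedSpace (Circ L (copies p N)) := preconnectedSpace_circ
  -- the parts of the circle `Circ L (copies p N)` over which `A` and its complement lie
  let T : Set (Solenoid L p) → Set (Circ L (copies p N)) := fun B =>
    ⋃₀ {V | IsOpen V ∧ ∀ s : Solenoid L p, s.1 N ∈ V → s ∈ B}
  have hT : ∀ B, IsOpen (T B) := fun B => isOpen_sUnion fun V hV => hV.1
  have hTB : ∀ B (s : Solenoid L p), s.1 N ∈ T B → s ∈ B := by
    rintro B s ⟨V, hV, hs⟩
    exact hV.2 s hs
  have hcov : ∀ c, c ∈ T A ∨ c ∈ T Aᶜ := by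
    intro c
    obtain ⟨V, hV, hc, U, rfl | rfl, h⟩ := hN c
    exacts [Or.inl ⟨V, ⟨hV, h⟩, hc⟩, Or.inr ⟨V, ⟨hV, h⟩, hc⟩]
  have hcompl : (T A)ᶜ = T Aᶜ := by
    ext c
    refine ⟨(hcov c).resolve_left, fun h h' => ?_⟩
    obtain ⟨s, rfl⟩ := exists_apply_eq N c
    exact hTB _ s h (hTB _ s h')
  rcases isClopen_iff.1 (⟨⟨hcompl ▸ hT _⟩, hT A⟩ : IsClopen (T A)) with h | h
  · refine Or.inl (Set.eq_empty_of_forall_notMem fun s hs => ?_)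
    exact hTB _ s ((hcov (s.1 N)).resolve_left (h ▸ Set.notMem_empty _)) hs
  · exact Or.inr (Set.eq_univ_of_forall fun s => hTB A s (h ▸ Set.mem_univ _))

theorem isContinuum_solenoid (hL : IsOrderedContinuum L) : IsContinuum (Solenoid L p) := by
  have := hL.orderTopology
  have := hL.compactSpace
  have := hL.connectedSpace
  have := hL.nontrivial
  have hc : CompactSpace (Solenoid L p) := compactSpace_solenoid
  exact ⟨hc, { toPreconnectedSpace := preconnectedSpace_solenoid, toNonempty := ⟨solPt p 0 ⊥⟩ },
    inferInstance⟩

/-- Homeomorphisms of the circles that commute with the covering maps induce a homeomorphism of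
the inverse limit. -/
def limitHomeo (g : ∀ n, Circ L (copies p n) ≃ₜ Circ L (copies p n))
    (hg : ∀ n z, bond L (p n) (copies p n) (g (n + 1) z) = g n (bond L (p n) (copies p n) z)) :
    Solenoid L p ≃ₜ Solenoid L p where
  toFun s := ⟨fun n => g n (s.1 n), fun n => by rw [hg, s.2]⟩
  invFun s := ⟨fun n => (g n).symm (s.1 n), fun n => by
    rw [Homeomorph.eq_symm_apply, ← hg, Homeomorph.apply_symm_apply, s.2]⟩
  left_inv s := Subtype.ext (funext fun n => (g n).symm_apply_apply _)
  right_inv s := Subtype.ext (funext fun n => (g n).apply_symm_apply _)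
  continuous_toFun := Continuous.subtype_mk
    (continuous_pi fun n => (g n).continuous.comp (continuous_apply_solenoid n)) _
  continuous_invFun := Continuous.subtype_mk
    (continuous_pi fun n => (g n).symm.continuous.comp (continuous_apply_solenoid n)) _

/-- A point over the common end point of the first circle is the image of the base point under a
compatible system of rotations. -/
theorem exists_homeo_of_apply_zero_eq [Nontrivial L] {s : Solenoid L p}
    (hs : s.1 0 = pt (copies p 0) 0 ⊥) :
    ∃ h : Solenoid L p ≃ₜ Solenoid L p, h (solPt p 0 ⊥) = s := by
  have : ∀ n, ∃ c : ℕ, s.1 n = pt (copies p n) c ⊥ := by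
    intro n
    obtain ⟨i, -, x, hx⟩ := exists_eq_pt (s.1 n)
    rcases eq_bot_or_eq_top_of_pt_eq_pt_bot ((apply_eq_pt_of_le (Nat.zero_le n) hx).symm.trans hs)
      with rfl | rfl
    · exact ⟨i, hx⟩
    · exact ⟨i + 1, by rw [hx, pt_top]⟩
  choose c hc using this
  refine ⟨limitHomeo (fun n => rotationHomeo (copies p n) (c n)) fun n z => ?_, ?_⟩
  · have hmod : c (n + 1) ≡ c n [MOD copies p n] := by
      rw [← pt_bot_eq_pt_bot (L := L), ← hc n]
      exact (apply_eq_pt_of_le n.le_succ (hc (n + 1))).symm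
    obtain ⟨i, -, x, rfl⟩ := exists_eq_pt (n := copies p (n + 1)) z
    rw [rotationHomeo_pt, bond_copies_pt, bond_copies_pt, rotationHomeo_pt]
    exact pt_congr (hmod.add_left i) x
  · refine Subtype.ext (funext fun n => ?_)
    change rotationHomeo (copies p n) (c n) (pt (copies p n) 0 ⊥) = s.1 n
    rw [rotationHomeo_pt, zero_add, hc]

theorem isHomogeneous_solenoid (hL : IsOrderedContinuum L) (hom : IsOrderHomogeneous L) :
    IsHomogeneous (Solenoid L p) := by
  have := hL.nontrivial
  have key : ∀ s : Solenoid L p, ∃ h : Solenoid L p ≃ₜ Solenoid L p, h (solPt p 0 ⊥) = s := by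
    intro s
    obtain ⟨i, hi, x, hx⟩ := exists_eq_pt (s.1 0)
    obtain rfl : i = 0 := Nat.lt_one_iff.1 hi
    by_cases h0 : x = ⊥
    · exact exists_homeo_of_apply_zero_eq (h0 ▸ hx)
    by_cases h1 : x = ⊤
    · refine exists_homeo_of_apply_zero_eq ?_
      rw [hx, h1, pt_top]
      exact pt_congr (Nat.modEq_zero_iff_dvd.2 dvd_rfl) _
    obtain ⟨g, hg, hgb⟩ := exists_halfRotation hL hom (bot_lt_iff_ne_bot.2 h0)
      (lt_top_iff_ne_top.2 h1)
    let G : Solenoid L p ≃ₜ Solenoid L p := limitHomeo (fun n => g (copies p n)) fun n z =>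
      haveI : NeZero (p n * copies p n) := hz (n + 1)
      hgb (p n) (copies p n) z
    obtain ⟨h, hh⟩ := exists_homeo_of_apply_zero_eq (s := G.symm s) (by
      change (g (copies p 0)).symm (s.1 0) = _
      rw [Homeomorph.symm_apply_eq, hg, hx])
    exact ⟨h.trans G, by rw [Homeomorph.trans_apply, hh, Homeomorph.apply_symm_apply]⟩
  intro s t
  obtain ⟨h, rfl⟩ := key s
  obtain ⟨k, rfl⟩ := key t
  exact ⟨h.symm.trans k, by simp⟩

theorem injective_solPt [Nontrivial L] (hp : ∀ n, 2 ≤ p n) :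
    Function.Injective (solPt p 0 : L → Solenoid L p) := by
  intro x y h
  have h1 : pt (copies p 1) 0 x = pt (copies p 1) 0 y := congrFun (congrArg Subtype.val h) 1
  have h2 := two_le_copies_one hp
  have h3 := congrArg normalForm h1
  have h4 : (0 + 1) % copies p 1 = 1 := Nat.mod_eq_of_lt h2
  by_cases hx : x = ⊤ <;> by_cases hy : y = ⊤
  · rw [hx, hy]
  · rw [hx, normalForm_pt_top, normalForm_pt _ hy, h4] at h3
    simp at h3
  · rw [hy, normalForm_pt_top, normalForm_pt _ hx, h4] at h3
    simp at h3
  · rw [normalForm_pt _ hx, normalForm_pt _ hy] at h3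
    exact congrArg Prod.snd h3

theorem not_metrizableSpace_solenoid (hL : IsOrderedContinuum L)
    (hm : ¬ TopologicalSpace.MetrizableSpace L) (hp : ∀ n, 2 ≤ p n) :
    ¬ TopologicalSpace.MetrizableSpace (Solenoid L p) := by
  have := hL.compactSpace
  have := hL.nontrivial
  intro h
  exact hm ((continuous_solPt 0).isClosedEmbedding
    (injective_solPt hp)).isEmbedding.metrizableSpace

theorem isOpen_setOf_normalForm_div [Nontrivial L] [T2Space L] [CompactSpace L] {m n : ℕ}
    [NeZero n] [NeZero (m * n)] (j : ℕ) :
    IsOpen {c : Circ L (m * n) | bond L m n c ≠ pt n 0 ⊥ ∧ (normalForm c).1 / n = j} := by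
  rw [isOpen_circ_iff]
  intro i
  have : {x : L | pt (m * n) i x ∈
      {c : Circ L (m * n) | bond L m n c ≠ pt n 0 ⊥ ∧ (normalForm c).1 / n = j}} =
      {x : L | pt n i x ≠ pt n 0 ⊥} ∩ {_x : L | i % (m * n) / n = j} := by
    ext x
    simp only [Set.mem_ofPred_eq, Set.mem_inter_iff, bond_pt]
    refine and_congr_right fun h => ?_
    rw [normalForm_div h]
  rw [this]
  exact ((isOpen_compl_singleton.preimage (continuous_pt i))).inter isOpen_const

/-- A subcontinuum `C` that misses the base point misses, at some level, all points over the base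
point of that level; so at the next level it lies in one of the at least two arcs between such
points. A closed set that makes up the whole space together with `C` covers another arc, which is
mapped onto the circle of the previous level, and so is everything. -/
theorem eq_univ_of_union_eq_univ [Nontrivial L] [T2Space L] [CompactSpace L] (hp : ∀ n, 2 ≤ p n)
    {C D : Set (Solenoid L p)} (hC : IsClosed C) (hC' : IsConnected C) (hb : solPt p 0 ⊥ ∉ C)
    (hD : IsClosed D) (hCD : C ∪ D = Set.univ) : D = Set.univ := by
  refine Set.eq_univ_of_forall fun w => by_contra fun hw => ?_
  obtain ⟨n₁, V₁, -, hb₁, hV₁⟩ := exists_level_of_isOpen hC.isOpen_compl hb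
  obtain ⟨n₂, V₂, -, hb₂, hV₂⟩ := exists_level_of_isOpen hD.isOpen_compl hw
  obtain ⟨N, h₁, h₂⟩ : ∃ N, n₁ ≤ N ∧ n₂ ≤ N := ⟨max n₁ n₂, le_max_left _ _, le_max_right _ _⟩
  have hCN : ∀ s ∈ C, s.1 N ≠ pt (copies p N) 0 ⊥ := by
    intro s hs h
    refine hV₁ s ?_ hs
    rw [apply_eq_pt_of_le h₁ h]
    exact hb₁
  obtain ⟨i, hi, x, hx⟩ := exists_eq_pt (w.1 N)
  have hDN : ∀ s ∈ D, s.1 N ≠ pt (copies p N) i x := by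
    intro s hs h
    refine hV₂ s ?_ hs
    rw [apply_eq_pt_of_le h₂ h, ← apply_eq_pt_of_le h₂ hx]
    exact hb₂
  have : NeZero (p N * copies p N) := hz (N + 1)
  let J : Solenoid L p → ℕ := fun s =>
    (normalForm (n := p N * copies p N) (s.1 (N + 1))).1 / copies p N
  have hJ : ContinuousOn J C := by
    intro s hs
    refine ContinuousAt.continuousWithinAt ?_
    have hO := (isOpen_setOf_normalForm_div (L := L) (m := p N) (n := copies p N) (J s)).preimage
      (continuous_apply_solenoid (p := p) (N + 1))
    have hsO : s ∈ (fun s : Solenoid L p => s.1 (N + 1)) ⁻¹'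
        {c : Circ L (p N * copies p N) | bond L (p N) (copies p N) c ≠ pt (copies p N) 0 ⊥ ∧
          (normalForm c).1 / copies p N = J s} := by
      refine ⟨?_, rfl⟩
      rw [s.2 N]
      exact hCN s hs
    refine (continuousAt_const (y := J s)).congr ?_
    filter_upwards [hO.mem_nhds hsO] with t ht using ht.2.symm
  obtain ⟨c, hc⟩ := hC'.nonempty
  -- a second arc, of which no point lies on `C`
  obtain ⟨j, hj, hjc⟩ : ∃ j < p N, j ≠ J c := by
    have := hp N
    by_cases h : J c = 0
    · exact ⟨1, by omega, by omega⟩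
    · exact ⟨0, by omega, fun e => h e.symm⟩
  let q : Solenoid L p := solPt p (i + j * copies p N) x
  have hqN : q.1 N = pt (copies p N) i x := pt_congr (by simp [Nat.ModEq]) x
  have hqC : q ∈ C := by
    have : q ∈ C ∪ D := hCD ▸ Set.mem_univ q
    exact this.resolve_right fun h => hDN q h hqN
  have hJq : J q = J c := hC'.isPreconnected.constant hJ hqC hc
  refine hjc (hJq ▸ ?_)
  have h1 := normalForm_div (m := p N) (hCN q hqC)
  have hlt : i + j * copies p N < p N * copies p N := by
    calc i + j * copies p N < copies p N + j * copies p N := by omega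
      _ = (j + 1) * copies p N := by ring
      _ ≤ p N * copies p N := Nat.mul_le_mul_right _ hj
  rw [Nat.mod_eq_of_lt hlt, Nat.add_mul_div_right _ _ (NeZero.pos _), Nat.div_eq_of_lt hi,
    zero_add] at h1
  exact h1.symm

theorem isIndecomposable_solenoid (hL : IsOrderedContinuum L) (hom : IsOrderHomogeneous L)
    (hp : ∀ n, 2 ≤ p n) : IsIndecomposable (Solenoid L p) := by
  have := hL.orderTopology
  have := hL.compactSpace
  have := hL.nontrivial
  rintro ⟨C, D, ⟨hC, hC', hCu⟩, ⟨hD, -, hDu⟩, hCD⟩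
  obtain ⟨z, hz'⟩ := (Set.ne_univ_iff_exists_notMem C).1 hCu
  obtain ⟨h, hh⟩ := isHomogeneous_solenoid hL hom z (solPt p 0 ⊥)
  refine hDu ?_
  have := eq_univ_of_union_eq_univ hp (C := h '' C) (D := h '' D)
    (h.isClosedMap _ hC.isClosed) (hC'.image h h.continuous.continuousOn)
    (by rwa [← hh, h.injective.mem_set_image]) (h.isClosedMap _ hD.isClosed)
    (by rw [← Set.image_union, hCD, Set.image_univ, h.surjective.range_eq])
  rwa [← h.surjective.range_eq, ← Set.image_univ, h.injective.image_injective.eq_iff] at this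

end Solenoid

/-! ### Circular chains -/

section Chain

variable {L : Type u} [LinearOrder L] [BoundedOrder L]

/-- `Chain E r b` says that `[⊥, b]` has a subdivision into `r` intervals, any two points of the
same one of which are in the relation `E`. -/
inductive Chain (E : L → L → Prop) : ℕ → L → Prop
  | zero : Chain E 0 ⊥
  | succ {r : ℕ} {a b : L} : Chain E r a → a < b →
      (∀ u ∈ Set.Icc a b, ∀ v ∈ Set.Icc a b, E u v) → Chain E (r + 1) b

theorem Chain.exists_of_le {E : L → L → Prop} {r : ℕ} {b c : L} (h : Chain E r b) (hc : c ≤ b) :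
    ∃ r', Chain E r' c := by
  induction h with
  | zero => exact ⟨0, le_bot_iff.1 hc ▸ Chain.zero⟩
  | @succ r a b ha hab hE ih =>
    rcases le_or_gt c a with h | h
    · exact ih h
    · exact ⟨r + 1, ha.succ h fun u hu v hv => hE u ⟨hu.1, hu.2.trans hc⟩ v ⟨hv.1, hv.2.trans hc⟩⟩

variable [TopologicalSpace L] [OrderTopology L]

/-- By connectedness: the set of the end points of chains is both open and closed. -/
theorem exists_chain [PreconnectedSpace L] {E : L → L → Prop}
    (hE : ∀ c : L, ∃ O ∈ nhds c, ∀ u ∈ O, ∀ v ∈ O, E u v) (b : L) : ∃ r, Chain E r b := by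
  let B : Set L := {b | ∃ r, Chain E r b}
  have key : ∀ c : L, ∃ W ∈ nhds c, (∃ b ∈ W, b ∈ B) → W ⊆ B := by
    intro c
    obtain ⟨O, hO, h⟩ := hE c
    refine ⟨O.ordConnectedComponent c, Set.ordConnectedComponent_mem_nhds.2 hO, ?_⟩
    rintro ⟨b, hb, r, hr⟩ d hd
    rcases le_or_gt d b with hdb | hbd
    · exact hr.exists_of_le hdb
    · have hsub : Set.Icc b d ⊆ O :=
        ((inferInstance : (O.ordConnectedComponent c).OrdConnected).out hb hd).trans
          Set.ordConnectedComponent_subset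
      exact ⟨r + 1, hr.succ hbd fun u hu v hv => h u (hsub hu) v (hsub hv)⟩
  have hB : IsClopen B := by
    refine ⟨⟨isOpen_iff_mem_nhds.2 fun c hc => ?_⟩, isOpen_iff_mem_nhds.2 fun c hc => ?_⟩
    · obtain ⟨W, hW, h⟩ := key c
      exact Filter.mem_of_superset hW fun d hd hdB => hc (h ⟨d, hd, hdB⟩ (mem_of_mem_nhds hW))
    · obtain ⟨W, hW, h⟩ := key c
      exact Filter.mem_of_superset hW (h ⟨c, mem_of_mem_nhds hW, hc⟩)
  have : B = Set.univ := hB.eq_univ ⟨⊥, 0, Chain.zero⟩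
  exact this.ge (Set.mem_univ b)

/-- A subdivision of `[⊥, b]` into `r` small intervals with end points `x 0, …, x r` gives a
continuous function that takes the `s`th interval into `[s, s + 1]`. -/
theorem Chain.exists_staircase [CompactSpace L] {E : L → L → Prop} {r : ℕ} {b : L}
    (h : Chain E r b) :
    (r = 0 → b = ⊥) ∧ ∃ (f : L → ℝ) (x : ℕ → L), Continuous f ∧ f ⊥ = 0 ∧ (∀ z, b ≤ z → f z = r) ∧
      x 0 = ⊥ ∧ x r = b ∧ ∀ z ≤ b, 0 < r → ∃ s < r, (s : ℝ) ≤ f z ∧ f z ≤ s + 1 ∧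
        E (x s) z ∧ E (x (s + 1)) z := by
  induction h with
  | zero =>
    exact ⟨fun _ => rfl, fun _ => 0, fun _ => ⊥, continuous_const, rfl, by simp, rfl, rfl,
      fun _ _ h => absurd h (lt_irrefl 0)⟩
  | @succ r a b ha hab hE ih =>
    obtain ⟨hr0, f, x, hf, f0, fr, x0, xr, hx⟩ := ih
    obtain ⟨g, hg0, hg1, hg⟩ := exists_continuous_zero_one_of_isClosed (s := Set.Iic a)
      (t := Set.Ici b) isClosed_Iic isClosed_Ici
      (Set.disjoint_left.2 fun z h1 h2 => (lt_irrefl _ ((hab.trans_le h2).trans_le h1)))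
    let y : ℕ → L := fun s => if s ≤ r then x s else b
    have y1 : ∀ s ≤ r, y s = x s := fun s hs => if_pos hs
    have y2 : y (r + 1) = b := if_neg (by omega)
    refine ⟨fun h => absurd h r.succ_ne_zero, fun z => f z + g z, y, hf.add g.continuous, ?_,
      fun z hz => ?_, ?_, y2, fun z hz _ => ?_⟩
    · simp [f0, hg0 (show ⊥ ≤ a from bot_le)]
    · simp [fr z (hab.le.trans hz), hg1 (show b ≤ z from hz)]
    · rw [y1 0 r.zero_le, x0]
    · rcases lt_or_ge z a with hza | haz
      · have hr : 0 < r := Nat.pos_of_ne_zero fun h => by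
          rw [hr0 h] at hza
          exact not_lt_bot hza
        obtain ⟨s, hs, h1, h2, h3, h4⟩ := hx z hza.le hr
        have hgz : g z = 0 := hg0 (show z ≤ a from hza.le)
        refine ⟨s, by omega, ?_, ?_, ?_, ?_⟩
        · simpa only [hgz, add_zero] using h1
        · simpa only [hgz, add_zero] using h2
        · rwa [y1 s hs.le]
        · rwa [y1 (s + 1) hs]
      · refine ⟨r, by omega, ?_, ?_, ?_, ?_⟩
        · simpa only [fr z haz, le_add_iff_nonneg_right] using (hg z).1
        · simpa only [fr z haz, add_le_add_iff_left] using (hg z).2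
        · rw [y1 r le_rfl, xr]
          exact hE _ ⟨le_rfl, hab.le⟩ _ ⟨haz, hz⟩
        · rw [y2]
          exact hE _ ⟨hab.le, le_rfl⟩ _ ⟨haz, hz⟩

end Chain

section CircleLike

theorem addCircle_coe_eq_coe_iff {T y z : ℝ} :
    (y : AddCircle T) = z ↔ ∃ m : ℤ, z - y = m * T := by
  rw [eq_comm, ← sub_eq_zero, ← AddCircle.coe_sub, AddCircle.coe_eq_zero_iff]
  simp only [zsmul_eq_mul, eq_comm]

/-- The intervals `(j - 1, j + 1)` form a circular chain of open sets on the metric circle of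
length `t`, and their preimages under a continuous surjection do so as well. -/
theorem exists_circularChain_of_surjective {X : Type u} [TopologicalSpace X] {t : ℕ} (ht : 0 < t)
    {F : X → AddCircle (t : ℝ)} (hF : Continuous F) (hs : Function.Surjective F) :
    ∃ U : Fin t → Set X, (∀ i, IsOpen (U i)) ∧ (⋃ i, U i) = Set.univ ∧ IsCircularChain U ∧
      ∀ j, ∀ c ∈ U j, ∃ y : ℝ, (j : ℝ) - 1 < y ∧ y < j + 1 ∧ F c = y := by
  refine ⟨fun j => F ⁻¹' ((fun y : ℝ => (y : AddCircle (t : ℝ))) '' Set.Ioo ((j : ℝ) - 1) (j + 1)),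
    fun j => (QuotientAddGroup.isOpenMap_coe _ isOpen_Ioo).preimage hF, ?_, ?_, ?_⟩
  · refine Set.eq_univ_of_forall fun c => Set.mem_iUnion.2 ?_
    obtain ⟨y, hy⟩ := QuotientAddGroup.mk_surjective (F c)
    have htz : (0 : ℤ) < t := by exact_mod_cast ht
    have h0 := Int.emod_nonneg ⌊y⌋ htz.ne'
    have h1 := Int.emod_lt_of_pos ⌊y⌋ htz
    have h2 := Int.emod_add_mul_ediv ⌊y⌋ t
    obtain ⟨j, hj⟩ := Int.eq_ofNat_of_zero_le h0
    refine ⟨⟨j, by omega⟩, y - (⌊y⌋ / t : ℤ) * t, ?_, ?_⟩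
    · have h3 : ((j : ℕ) : ℝ) + t * ((⌊y⌋ / t : ℤ) : ℝ) = ⌊y⌋ := by
        rw [hj] at h2
        exact_mod_cast h2
      have h4 := Int.floor_le y
      have h5 := Int.lt_floor_add_one y
      constructor
      · simp only
        linarith
      · simp only
        linarith
    · refine Eq.trans ?_ hy
      exact addCircle_coe_eq_coe_iff.2 ⟨⌊y⌋ / t, by ring⟩
  · intro i j
    constructor
    · rintro ⟨c, ⟨y, ⟨hy1, hy2⟩, hy⟩, ⟨z, ⟨hz1, hz2⟩, hz⟩⟩
      obtain ⟨m, hm⟩ := addCircle_coe_eq_coe_iff.1 (hy.trans hz.symm)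
      -- the centres `i` and `j - m t` are less than `2` apart
      have h1 : ((j : ℕ) : ℤ) - (i : ℕ) - m * t < 2 := by
        have : ((j : ℕ) : ℝ) - (i : ℕ) - m * t < 2 := by linarith
        exact_mod_cast this
      have h2 : -2 < ((j : ℕ) : ℤ) - (i : ℕ) - m * t := by
        have : (-2 : ℝ) < ((j : ℕ) : ℝ) - (i : ℕ) - m * t := by linarith
        exact_mod_cast this
      simp only [Nat.modEq_iff_dvd]
      have h3 : ((j : ℕ) : ℤ) - (i : ℕ) - m * t = 0 ∨ ((j : ℕ) : ℤ) - (i : ℕ) - m * t = 1 ∨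
        ((j : ℕ) : ℤ) - (i : ℕ) - m * t = -1 := by omega
      rcases h3 with h | h | h
      · exact Or.inl ⟨m, by linarith⟩
      · exact Or.inr (Or.inl ⟨m, by push_cast; linarith⟩)
      · exact Or.inr (Or.inr ⟨m, by push_cast; linarith⟩)
    · simp only [Nat.modEq_iff_dvd]
      rintro (⟨m, hm⟩ | ⟨m, hm⟩ | ⟨m, hm⟩)
      · have hm' : ((j : ℕ) : ℝ) - (i : ℕ) = t * m := by exact_mod_cast hm
        obtain ⟨c, hc⟩ := hs ((i : ℕ) : ℝ)
        refine ⟨c, ⟨(i : ℕ), ⟨by linarith, by linarith⟩, hc.symm⟩,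
          ⟨(j : ℕ), ⟨by linarith, by linarith⟩, ?_⟩⟩
        rw [hc]
        exact (addCircle_coe_eq_coe_iff.2 ⟨m, by linarith⟩).symm
      · have hm' : ((j : ℕ) : ℝ) - ((i : ℕ) + 1) = t * m := by exact_mod_cast hm
        obtain ⟨c, hc⟩ := hs (((i : ℕ) : ℝ) + 1 / 2 : ℝ)
        refine ⟨c, ⟨(i : ℕ) + 1 / 2, ⟨by linarith, by linarith⟩, hc.symm⟩,
          ⟨(j : ℕ) - 1 / 2, ⟨by linarith, by linarith⟩, ?_⟩⟩
        rw [hc]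
        exact (addCircle_coe_eq_coe_iff.2 ⟨m, by linarith⟩).symm
      · have hm' : ((j : ℕ) : ℝ) + 1 - (i : ℕ) = t * m := by exact_mod_cast hm
        obtain ⟨c, hc⟩ := hs (((i : ℕ) : ℝ) - 1 / 2 : ℝ)
        refine ⟨c, ⟨(i : ℕ) - 1 / 2, ⟨by linarith, by linarith⟩, hc.symm⟩,
          ⟨(j : ℕ) + 1 / 2, ⟨by linarith, by linarith⟩, ?_⟩⟩
        rw [hc]
        exact (addCircle_coe_eq_coe_iff.2 ⟨m, by linarith⟩).symm
  · rintro j c ⟨y, ⟨h1, h2⟩, h⟩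
    exact ⟨y, h1, h2, h.symm⟩

variable {L : Type u} [LinearOrder L] [BoundedOrder L] [TopologicalSpace L]

/-- A fine subdivision of `L` gives a map of the circle of `n` copies of `L` onto a metric circle
under which the preimages of the intervals `(j - 1, j + 1)` are small. -/
theorem isCircleLike_circ (hL : IsOrderedContinuum L) {n : ℕ} [NeZero n] (hn : 3 ≤ n) :
    IsCircleLike (Circ L n) := by
  have := hL.orderTopology
  have := hL.compactSpace
  have := hL.connectedSpace
  have := hL.nontrivial
  intro 𝒰 ho hc
  let := uniformSpaceOfCompactR1 (γ := Circ L n)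
  obtain ⟨V, hV, hVU⟩ := lebesgue_number_lemma_sUnion (isCompact_univ (X := Circ L n)) ho hc.ge
  obtain ⟨r, hr⟩ := exists_chain (E := fun u v : L => ∀ i : Fin n, (pt n i u, pt n i v) ∈ V)
    (fun c => by
      have : ∀ᶠ q : L × L in nhds (c, c), ∀ i : Fin n, (pt n i q.1, pt n i q.2) ∈ V := by
        rw [Filter.eventually_all]
        intro i
        have h := ((continuous_pt (L := L) (n := n) i).prodMap (continuous_pt (n := n) i)).tendsto
          (c, c)
        exact h (nhds_le_uniformity _ hV)
      rw [nhds_prod_eq] at this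
      obtain ⟨O, hO, h⟩ := Filter.mem_prod_same_iff.1 this
      exact ⟨O, hO, fun u hu v hv => h (Set.mk_mem_prod hu hv)⟩) ⊤
  obtain ⟨hr0, f, x, hf, f0, fr, x0, xr, hx⟩ := hr.exists_staircase
  have hrpos : 0 < r := Nat.pos_of_ne_zero fun h => top_ne_bot (hr0 h)
  have hnpos : 0 < n := NeZero.pos n
  have ht : 0 < n * r := Nat.mul_pos hnpos hrpos
  -- the map of the circle onto the metric circle
  let φ : ℕ → L → AddCircle ((n * r : ℕ) : ℝ) := fun i z => ((i * r + f z : ℝ) : AddCircle _)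
  have hper : ∀ i z, φ (i % n) z = φ i z := by
    intro i z
    refine addCircle_coe_eq_coe_iff.2 ⟨(i / n : ℕ), ?_⟩
    have h : (n : ℝ) * (i / n : ℕ) + (i % n : ℕ) = i := by exact_mod_cast Nat.div_add_mod i n
    rw [Int.cast_natCast, Nat.cast_mul]
    linear_combination -(r : ℝ) * h
  have hglue : ∀ i, φ i ⊤ = φ (i + 1) ⊥ := by
    intro i
    simp only [φ, fr ⊤ le_rfl, f0]
    push_cast
    congr 1
    ring
  let F : Circ L n → AddCircle ((n * r : ℕ) : ℝ) := circLift φ hper hglue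
  have hFpt : ∀ i z, F (pt n i z) = ((i * r + f z : ℝ) : AddCircle _) :=
    fun i z => circLift_pt _ _ _ i z
  have hF : Continuous F := continuous_circLift _ _ _ fun i =>
    (AddCircle.continuous_mk' _).comp (continuous_const.add hf)
  have hFs : Function.Surjective F := by
    intro a
    obtain ⟨y, ⟨hy0, -⟩, rfl⟩ : ∃ y ∈ Set.Ico (0 : ℝ) (0 + (n * r : ℕ)), (y : AddCircle _) = a := by
      have : Fact (0 < ((n * r : ℕ) : ℝ)) := ⟨by exact_mod_cast ht⟩
      exact ⟨_, (AddCircle.equivIco _ 0 a).2, AddCircle.coe_equivIco⟩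
    have hr' : (0 : ℝ) < r := by exact_mod_cast hrpos
    have h1 := Nat.floor_le (div_nonneg hy0 hr'.le)
    have h2 := Nat.lt_floor_add_one (y / r)
    rw [le_div_iff₀ hr'] at h1
    rw [div_lt_iff₀ hr'] at h2
    obtain ⟨z, hz⟩ := mem_range_of_exists_le_of_exists_ge hf
      (c := y - ⌊y / r⌋₊ * r) ⟨⊥, by rw [f0]; linarith⟩
      ⟨⊤, by rw [fr ⊤ le_rfl]; linarith⟩
    exact ⟨pt n ⌊y / r⌋₊ z, by rw [hFpt, hz]; congr 1; ring⟩
  obtain ⟨U, hUo, hUc, hUchain, hU⟩ := exists_circularChain_of_surjective ht hF hFs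
  refine ⟨n * r, hn.trans (Nat.le_mul_of_pos_right n hrpos), U, hUo, hUc, fun j => ?_, hUchain⟩
  -- the points of subdivision of the circle
  let w : ℕ → Circ L n := fun k => pt n (k / r) (x (k % r))
  have hw : ∀ i s, s ≤ r → w (i * r + s) = pt n i (x s) := by
    intro i s hs
    rcases hs.eq_or_lt with rfl | hs
    · simp only [w]
      rw [show i * s + s = (i + 1) * s by ring, Nat.mul_div_cancel _ hrpos, Nat.mul_mod_left, x0,
        xr, pt_top]
    · simp only [w]
      rw [show i * r + s = s + i * r by ring, Nat.add_mul_div_right _ _ hrpos,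
        Nat.add_mul_mod_self_right, Nat.div_eq_of_lt hs, Nat.mod_eq_of_lt hs, zero_add]
  have hwmod : ∀ k l, k ≡ l [MOD n * r] → w k = w l := by
    have : ∀ k, w (k % (n * r)) = w k := by
      intro k
      simp only [w]
      rw [Nat.mul_comm n r, Nat.mod_mul_right_div_self, Nat.mod_mul_right_mod]
      exact pt_congr (Nat.mod_modEq _ _) _
    intro k l h
    rw [← this k, ← this l, h]
  obtain ⟨W, hW, hball⟩ := hVU (w j) trivial
  refine ⟨W, hW, fun c hc => hball ?_⟩
  change (w j, c) ∈ V
  obtain ⟨y, hy1, hy2, hy⟩ := hU j c hc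
  obtain ⟨i, hi, z, rfl⟩ := exists_eq_pt c
  obtain ⟨s, hs, hs1, hs2, hE1, hE2⟩ := hx z le_top hrpos
  rw [hFpt] at hy
  obtain ⟨m, hm⟩ : ∃ m : ℤ, (i * r + f z : ℝ) - y = m * (n * r : ℕ) :=
    addCircle_coe_eq_coe_iff.1 hy.symm
  have h1 : ((i * r + s : ℕ) : ℤ) - m * (n * r : ℕ) < j + 1 := by
    have : ((i * r + s : ℕ) : ℝ) - m * (n * r : ℕ) < (j : ℕ) + 1 := by
      push_cast at hm ⊢; linarith
    exact_mod_cast this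
  have h2 : ((j : ℕ) : ℤ) - 2 < ((i * r + s : ℕ) : ℤ) - m * (n * r : ℕ) := by
    have : ((j : ℕ) : ℝ) - 2 < ((i * r + s : ℕ) : ℝ) - m * (n * r : ℕ) := by
      push_cast at hm ⊢; linarith
    exact_mod_cast this
  have h3 : ((i * r + s : ℕ) : ℤ) - m * (n * r : ℕ) = j ∨
      ((i * r + s : ℕ) : ℤ) - m * (n * r : ℕ) = j - 1 := by omega
  rcases h3 with h | h
  · have : w j = pt n i (x s) := by
      rw [← hw i s hs.le]
      exact hwmod _ _ (Nat.modEq_iff_dvd.2 ⟨m, by rw [← h]; ring⟩)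
    rw [this]
    exact hE1 ⟨i, hi⟩
  · have : w j = pt n i (x (s + 1)) := by
      rw [← hw i (s + 1) hs]
      exact hwmod _ _ (Nat.modEq_iff_dvd.2 ⟨m, by
        rw [← add_assoc, Nat.cast_add _ 1, Nat.cast_one]; linarith⟩)
    rw [this]
    exact hE2 ⟨i, hi⟩

end CircleLike

section Solenoid

variable {L : Type u} [LinearOrder L] [BoundedOrder L] [TopologicalSpace L] {p : ℕ → ℕ}

theorem two_pow_le_copies (hp : ∀ n, 2 ≤ p n) (n : ℕ) : 2 ^ n ≤ copies p n := by
  induction n with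
  | zero => exact le_rfl
  | succ n ih =>
    rw [pow_succ']
    exact Nat.mul_le_mul (hp n) ih

theorem isCircleLike_solenoid [hz : ∀ n, NeZero (copies p n)] (hL : IsOrderedContinuum L)
    (hp : ∀ n, 2 ≤ p n) : IsCircleLike (Solenoid L p) := by
  have := (isContinuum_solenoid (p := p) hL).compactSpace
  intro 𝒰 ho hc
  obtain ⟨N, hN, h⟩ := exists_level_of_cover 2 ho hc
  have h3 : 3 ≤ copies p N := calc
    3 ≤ 2 ^ 2 := by norm_num
    _ ≤ 2 ^ N := Nat.pow_le_pow_right (by norm_num) hN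
    _ ≤ copies p N := two_pow_le_copies hp N
  obtain ⟨t, ht, U, hUo, hUc, hUV, hU⟩ := isCircleLike_circ hL h3
    {V | IsOpen V ∧ ∃ U ∈ 𝒰, ∀ s : Solenoid L p, s.1 N ∈ V → s ∈ U} (fun V hV => hV.1)
    (Set.eq_univ_of_forall fun c => by
      obtain ⟨V, hV, hcV, hVU⟩ := h c
      exact ⟨V, ⟨hV, hVU⟩, hcV⟩)
  refine ⟨t, ht, fun i => {s | s.1 N ∈ U i},
    fun i => (hUo i).preimage (continuous_apply_solenoid N), ?_, fun i => ?_, fun i j => ?_⟩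
  · refine Set.eq_univ_of_forall fun s => Set.mem_iUnion.2 ?_
    obtain ⟨i, hi⟩ := Set.mem_iUnion.1 (hUc.ge (Set.mem_univ (s.1 N)))
    exact ⟨i, hi⟩
  · obtain ⟨V, ⟨-, W, hW, hVW⟩, hUV⟩ := hUV i
    exact ⟨W, hW, fun s hs => hVW s (hUV hs)⟩
  · rw [← hU i j]
    constructor
    · rintro ⟨s, h1, h2⟩
      exact ⟨s.1 N, h1, h2⟩
    · rintro ⟨c, h1, h2⟩
      obtain ⟨s, rfl⟩ := exists_apply_eq N c
      exact ⟨s, h1, h2⟩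

end Solenoid

end LongSolenoid

theorem mainTheorem5 :
    (∃ (L : Type u) (_ : LinearOrder L) (_ : BoundedOrder L) (_ : TopologicalSpace L),
      IsOrderedContinuum L ∧ IsOrderHomogeneous L ∧ ¬ TopologicalSpace.MetrizableSpace L) ∧
    (∀ (L : Type u) [LinearOrder L] [BoundedOrder L] [TopologicalSpace L],
      IsOrderedContinuum L → IsOrderHomogeneous L → ¬ TopologicalSpace.MetrizableSpace L →
      ∀ p : ℕ → ℕ, (∀ n, 2 ≤ p n) →
        IsContinuum (Solenoid L p) ∧
        IsHomogeneous (Solenoid L p) ∧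
        ¬ TopologicalSpace.MetrizableSpace (Solenoid L p) ∧
        IsIndecomposable (Solenoid L p) ∧
        IsCircleLike (Solenoid L p)) := by
  refine ⟨exists_nonmetrizable, fun L _ _ _ hL hom hm p hp => ?_⟩
  have : ∀ n, NeZero (copies p n) := fun n =>
    ⟨((Nat.two_pow_pos n).trans_le (two_pow_le_copies hp n)).ne'⟩
  exact ⟨isContinuum_solenoid hL, isHomogeneous_solenoid hL hom,
    not_metrizableSpace_solenoid hL hm hp, isIndecomposable_solenoid hL hom hp,
    isCircleLike_solenoid hL hp⟩
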